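/- Let $d\ge 1$ be an integer and let $\|\cdot\|$ be the Euclidean norm on $\mathbb{R}^d$; for $\mathbf{x}\in\mathbb{R}^d$ let $\lfloor\mathbf{x}\rfloor\in\mathbb{Z}^d$ be the componentwise integer part. **Linear process.** Let $\{\varepsilon(\mathbf{j}):\mathbf{j}\in\mathbb{Z}^d\}$ be independent random variables on a probability space, with mean $0$ and variance $1$, such that $\{\varepsilon(\mathbf{j})^2\}$ is uniformly integrable. Let $\mu\in\mathbb{R}$, let $\alpha:\mathbb{Z}^d\to\mathbb{R}$ satisfy $\sum_{\mathbf{i}}\alpha(\mathbf{i})^2<\infty$, and let $Z(\mathbf{i})=\mu+\sum_{\mathbf{j}\in\mathbb{Z}^d}\alpha(\mathbf{i}-\mathbf{j})\varepsilon(\mathbf{j})$, $\mathbf{i}\in\mathbb{Z}^d$, where the series converges in $L^2$. **Sampling regions.** Let $R_0\subset(-1/2,1/2]^d$ be open and connected, with $\mathbf{0}\in R_0$, and with boundary $\partial R_0$ of Lebesgue measure zero. Let $\lambda_n>0$, $\lambda_n\to\infty$, $R_n=\lambda_nR_0$, and $S_n=\sum_{\mathbf{i}\in R_n\cap\mathbb{Z}^d}Z(\mathbf{i})$.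 **Assumptions.** Let $\gamma(t)=\max\{|\alpha(\lfloor t\mathbf{u}\rfloor)|:\|\mathbf{u}\|=1\}$ for $t>0$. Let $\beta\in(d,d+\tfrac12)$, and suppose the following. (C.1) $\gamma(t)=t^{-\beta}L(t)$ for all $t>0$, where $L:(0,\infty)\to[0,\infty)$ is bounded on every bounded subinterval of $(0,\infty)$ and $\lim_{t\to\infty}\sup\{L(at)/L(t):a\in[a_0,a_1]\}=1$ for all $0<a_0<a_1<\infty$. (C.2) With $g_t(\mathbf{x})=\alpha(\lfloor t\mathbf{x}\rfloor)/\gamma(t)$, there is a measurable $g_\infty:\mathbb{R}^d\to\mathbb{R}$ such that $\int_{\{\|\mathbf{x}\|\ge\delta\}}|g_t(\mathbf{x})-g_\infty(\mathbf{x})|\,d\mathbf{x}\to0$ as $t\to\infty$, for every $\delta>0$. (C.3) For every measurable $f:[0,\infty)\to[0,\infty)$ there is $C_f\in(1,\infty)$ such that $$\int_{(\partial R_0)^\epsilon}f\bigl(d(\mathbf{x},\partial R_0)\bigr)\,d\mathbf{x}\le C_f\int_0^\epsilon f(t)\,dt\qquad\text{for all }0<\epsilon<C_f^{-1},$$ where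 $d(\mathbf{x},\partial R_0)$ is the distance from $\mathbf{x}$ to $\partial R_0$, $(\partial R_0)^\epsilon=\{\mathbf{x}:d(\mathbf{x},\partial R_0)\le\epsilon\}$, and the integrals take values in $[0,\infty]$. Finally, suppose that $A=\sum_{\mathbf{i}\in\mathbb{Z}^d}\alpha(\mathbf{i})=0$ (the series converges absolutely). **Theorem.** Define $$G^\dagger_\infty(\mathbf{x})=\begin{cases}\int_{R_0}g_\infty(\mathbf{y}-\mathbf{x})\,d\mathbf{y},&\mathbf{x}\in[R_0\cup\partial R_0]^c,\\ \int_{R_0^c}g_\infty(\mathbf{y}-\mathbf{x})\,d\mathbf{y},&\mathbf{x}\in R_0,\\ 0,&\mathbf{x}\in\partial R_0.\end{cases}$$ Then the integrals defining $G^\dagger_\infty$ converge absolutely, $G^\dagger_\infty\in L^2(\mathbb{R}^d)$, and, as $n\to\infty$, $$\frac{S_n-ES_n}{[\lambda_n^{3d-2\beta}L(\lambda_n)^2]^{1/2}}\ \xrightarrow{\,d\,}\ N\Bigl(0,\int_{\mathbb{R}^d}G^\dagger_\infty(\mathbf{x})^2\,d\mathbf{x}\Bigr),$$ where $N(0,0)$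 is the point mass at $0$ and the normalization is positive for all large $n$. -/

import Mathlib

open MeasureTheory ProbabilityTheory Filter Topology
open scoped ENNReal NNReal Pointwise

noncomputable section

namespace SpatialCLT

/-- `ℤ^d`. -/
abbrev Lattice (d : ℕ) : Type := Fin d → ℤ

/-- `ℝ^d` with the Euclidean norm and Lebesgue measure. -/
abbrev Space (d : ℕ) : Type := EuclideanSpace ℝ (Fin d)

/-- The inclusion of `ℤ^d` in `ℝ^d`. -/
def toSpace {d : ℕ} (i : Lattice d) : Space d := WithLp.toLp 2 (fun k => (i k : ℝ))

/-- The componentwise integer part `⌊x⌋` of `x ∈ ℝ^d`. -/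
def floorVec {d : ℕ} (x : Space d) : Lattice d := fun k => ⌊x k⌋

/-! ### The linear process -/

/-- Independent, zero mean, unit variance errors whose squares are uniformly integrable. -/
structure IsErrorField {d : ℕ} {Ω : Type*} [MeasurableSpace Ω]
    (ε : Lattice d → Ω → ℝ) (P : Measure Ω) : Prop where
  measurable : ∀ j, Measurable (ε j)
  indep : iIndepFun ε P
  memLp : ∀ j, MemLp (ε j) 2 P
  mean_zero : ∀ j, ∫ ω, ε j ω ∂P = 0
  variance_one : ∀ j, variance (ε j) P = 1
  unifIntegrable_sq : UniformIntegrable (fun j ω => ε j ω ^ 2) 1 P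

/-- `Z(i) = μ + ∑_{j ∈ ℤ^d} α(i - j) ε(j)` with `α` square summable and `ε` an error field; the
series is the limit in `L²(P)` of its finite partial sums, which determines each `Z(i)` almost
surely. -/
structure IsLinearProcess {d : ℕ} {Ω : Type*} [MeasurableSpace Ω]
    (Z : Lattice d → Ω → ℝ) (μ : ℝ) (α : Lattice d → ℝ) (ε : Lattice d → Ω → ℝ)
    (P : Measure Ω) : Prop where
  summable_sq : Summable (fun i => α i ^ 2)
  errors : IsErrorField ε P
  memLp : ∀ i, MemLp (Z i) 2 P
  series : ∀ i, Tendsto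
    (fun s : Finset (Lattice d) =>
      eLpNorm (fun ω => Z i ω - (μ + ∑ j ∈ s, α (i - j) * ε j ω)) 2 P)
    atTop (𝓝 0)

/-! ### The sampling region -/

/-- The prototype `R₀`: an open connected subset of `(-1/2, 1/2]^d` that contains the origin and
whose boundary is Lebesgue null. -/
structure IsPrototype {d : ℕ} (R₀ : Set (Space d)) : Prop where
  isOpen : IsOpen R₀
  isConnected : IsConnected R₀
  subset_cube : ∀ x ∈ R₀, ∀ k, x k ∈ Set.Ioc (-(1 / 2) : ℝ) (1 / 2)
  zero_mem : (0 : Space d) ∈ R₀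
  frontier_null : volume (frontier R₀) = 0

/-- The data sites `(c R₀) ∩ ℤ^d`. -/
def sites {d : ℕ} (R₀ : Set (Space d)) (c : ℝ) : Set (Lattice d) :=
  {i | toSpace i ∈ c • R₀}

/-- There are finitely many data sites, so that the sum below is a genuine finite sum. -/
theorem sites_finite {d : ℕ} {R₀ : Set (Space d)} (h : IsPrototype R₀) (c : ℝ) :
    (sites R₀ c).Finite := by
  refine (Set.finite_Icc (fun _ : Fin d => -⌈|c|⌉) (fun _ : Fin d => ⌈|c|⌉)).subset ?_
  rintro i ⟨x, hx, hxi⟩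
  have key : ∀ k, |(i k : ℝ)| ≤ |c| := by
    intro k
    have h1 := h.subset_cube x hx k
    have h2 : c * x k = (i k : ℝ) := by
      have := congrArg (fun y : Space d => y k) hxi
      simpa [toSpace] using this
    have h3 : |x k| ≤ 1 := abs_le.2 ⟨by linarith [h1.1], by linarith [h1.2]⟩
    rw [← h2, abs_mul]
    exact mul_le_of_le_one_right (abs_nonneg c) h3
  refine ⟨fun k => ?_, fun k => ?_⟩
  · have h1 := (abs_le.1 (key k)).1
    have h2 := Int.le_ceil |c|
    have h3 : (-(⌈|c|⌉ : ℤ) : ℝ) ≤ (i k : ℝ) := by linarith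
    exact_mod_cast h3
  · have h1 := (abs_le.1 (key k)).2
    have h2 := Int.le_ceil |c|
    have h3 : (i k : ℝ) ≤ ((⌈|c|⌉ : ℤ) : ℝ) := by linarith
    exact_mod_cast h3

/-- The sum of `Z(i)` over the data sites `i ∈ (c R₀) ∩ ℤ^d`. -/
def siteSum {d : ℕ} {Ω : Type*} (Z : Lattice d → Ω → ℝ) (R₀ : Set (Space d)) (c : ℝ)
    (ω : Ω) : ℝ :=
  ∑ᶠ i ∈ sites R₀ c, Z i ω

/-! ### The regularity conditions -/

/-- `γ(t) = max {|α(⌊t u⌋)| : ‖u‖ = 1}`. -/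
def radialMax {d : ℕ} (α : Lattice d → ℝ) (t : ℝ) : ℝ :=
  sSup {r : ℝ | ∃ u : Space d, ‖u‖ = 1 ∧ r = |α (floorVec (t • u))|}

/-- `L : (0, ∞) → [0, ∞)` is slowly varying at infinity: it is bounded on bounded subintervals of
`(0, ∞)`, and `sup {L(at) / L(t) : a ∈ [a₀, a₁]} → 1` as `t → ∞` whenever `0 < a₀ < a₁`. -/
structure SlowlyVarying (L : ℝ → ℝ) : Prop where
  nonneg : ∀ t, 0 < t → 0 ≤ L t
  bounded : ∀ T, 0 < T → ∃ K : ℝ, ∀ t, 0 < t → t ≤ T → L t ≤ K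
  tendsto : ∀ a₀ a₁ : ℝ, 0 < a₀ → a₀ < a₁ →
    Tendsto (fun t : ℝ => sSup ((fun a : ℝ => L (a * t) / L t) '' Set.Icc a₀ a₁)) atTop (𝓝 1)

/-- The radial maximum of the coefficients is `γ(t) = t^{-β} L(t)` with `β > d/2` and `L` slowly
varying. -/
structure RegularDecay {d : ℕ} (α : Lattice d → ℝ) (β : ℝ) (L : ℝ → ℝ) : Prop where
  exponent : (d : ℝ) / 2 < β
  slowly : SlowlyVarying L
  eq : ∀ t, 0 < t → radialMax α t = t ^ (-β) * L t

/-- `g_t(x) = α(⌊t x⌋) / γ(t)`. -/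
def scaledCoeff {d : ℕ} (α : Lattice d → ℝ) (t : ℝ) (x : Space d) : ℝ :=
  α (floorVec (t • x)) / radialMax α t

/-- The exponent `b(d, β)`. -/
def limitExponent (d : ℕ) (β : ℝ) : ℕ := open Classical in if β ≤ (d : ℝ) then 2 else 1

/-- `g_t → g` in `L^b({‖x‖ ≥ δ})` as `t → ∞`, for every `δ > 0`, where `b = b(d, β)`. -/
structure SpatialLimit {d : ℕ} (α : Lattice d → ℝ) (β : ℝ) (g : Space d → ℝ) : Prop where
  aemeasurable : AEMeasurable g volume
  tendsto : ∀ δ : ℝ, 0 < δ → Tendsto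
    (fun t : ℝ => ∫⁻ x in {x : Space d | δ ≤ ‖x‖},
      ENNReal.ofReal (|scaledCoeff α t x - g x| ^ limitExponent d β))
    atTop (𝓝 0)

/-- The closed enlargement `A^δ = {y : ‖z - y‖ ≤ δ for some z ∈ A}`. -/
def enlarge {d : ℕ} (A : Set (Space d)) (δ : ℝ) : Set (Space d) :=
  {y | ∃ z ∈ A, ‖z - y‖ ≤ δ}

/-- For every measurable `f : [0, ∞) → [0, ∞)` there is `C_f ∈ (1, ∞)` such that
`∫_{(∂R₀)^ε} f(d(x, ∂R₀)) dx ≤ C_f ∫_0^ε f(t) dt` for all `0 < ε < 1 / C_f`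
(the integrals take values in `[0, ∞]`). -/
def BoundaryRegular {d : ℕ} (R₀ : Set (Space d)) : Prop :=
  ∀ f : ℝ → ℝ, Measurable f → (∀ t, 0 ≤ t → 0 ≤ f t) →
    ∃ C : ℝ, 1 < C ∧ ∀ ε : ℝ, 0 < ε → ε < C⁻¹ →
      ∫⁻ x in enlarge (frontier R₀) ε, ENNReal.ofReal (f (Metric.infDist x (frontier R₀)))
        ≤ ENNReal.ofReal C * ∫⁻ t in Set.Ioc 0 ε, ENNReal.ofReal (f t)

/-! ### The limit function -/

open Classical in
/-- `G†(x) = ∫_{R₀} g(y - x) dy` off the closure of `R₀`, `∫_{R₀ᶜ} g(y - x) dy` on the open set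
`R₀`, and `0` on the boundary. -/
def limitG {d : ℕ} (R₀ : Set (Space d)) (g : Space d → ℝ) (x : Space d) : ℝ :=
  if x ∈ (R₀ ∪ frontier R₀)ᶜ then ∫ y in R₀, g (y - x)
  else if x ∈ R₀ then ∫ y in R₀ᶜ, g (y - x)
  else 0

end SpatialCLT

end

/-! Write `c` for `λ_n`. Interchanging the finite sum over the sites with the `L²` series gives `S_n
- ES_n = ∑_j a(j) ε(j)` in `L²`, where `a(j) = ∑_{i ∈ R_n} α(i - j)` is `shiftSum`. For such sums a
characteristic function argument (`tendstoInDistribution_of_weights`) reduces the limit theorem to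
two facts about the normalized weights: they are uniformly small, and their squares have convergent
sums. Smallness is immediate, since `|a(j)| ≤ ∑ |α|` and the normalization tends to infinity (`3d -
2β > d - 1 ≥ 0`).

For the squares, the normalization equals `c^{d/2} · c^d γ(c)`. Hence the sum of squared weights is
exactly `∫ G_c²` with `G_c(x) = a(⌊c x⌋) / (c^d γ(c))`, and it remains to pass to the limit in this
integral.

Pointwise, `G_c(x)` is the integral of `g_c` over a lattice approximation of `R₀ - x`. If `x` is off
the closure of `R₀`, that set avoids a ball around the origin and (C.2) gives the limit. If `x ∈
R₀`, the origin lies inside, where `g_∞` may fail to be integrable. Here `A = 0` enters: the sum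
over `R₀` is minus the sum over `R₀ᶜ`, which does avoid the origin. So `G_c` tends to `± G†` almost
everywhere, and squaring removes the sign.

The domination uses the same cancellation. At distance `ρ` from the boundary only coefficients of
norm at least about `cρ` count. Those outside radius `r` have total mass `O(r^d γ(r))`, so Potter's
bounds give `|G_c| ≤ C ρ^{-(β-d+δ)}`. Its square is integrable near the boundary by (C.3), because
`β < d + 1/2` leaves room for `2(β - d + δ) < 1`. Far away `G_c` decays like `‖x‖^{-(β-δ)}`, which
is square integrable. -/

noncomputable section

namespace SpatialCLT

/-! ### A central limit theorem for weighted infinite sums -/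

/-- The second order Taylor remainder of `y ↦ exp (i y)` is at most quadratic and cubic. -/
theorem norm_exp_mul_I_taylor_two (y : ℝ) :
    ‖Complex.exp (y * Complex.I) - 1 - y * Complex.I + y ^ 2 / 2‖ ≤ 4 * y ^ 2 ∧
    ‖Complex.exp (y * Complex.I) - 1 - y * Complex.I + y ^ 2 / 2‖ ≤ 4 * |y| ^ 3 := by
  have hn : ‖(y : ℂ) * Complex.I‖ = |y| := by simp
  rcases le_total |y| 1 with h | h
  · have h3 := Complex.exp_bound (x := y * Complex.I) (by rw [hn]; exact h) (n := 3) (by norm_num)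
    rw [hn] at h3
    have he : Complex.exp (y * Complex.I) - ∑ m ∈ Finset.range 3,
        (y * Complex.I) ^ m / m.factorial
        = Complex.exp (y * Complex.I) - 1 - y * Complex.I + y ^ 2 / 2 := by
      simp [Finset.sum_range_succ, Nat.factorial, mul_pow, Complex.I_sq]
      ring
    rw [he] at h3
    norm_num [Nat.factorial] at h3
    have h0 := abs_nonneg y
    have h4 : |y| ^ 3 ≤ y ^ 2 := by
      rw [← sq_abs y]
      exact pow_le_pow_of_le_one h0 h (by norm_num)
    constructor <;> nlinarith [pow_nonneg h0 3, sq_nonneg y]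
  · have h1 : ‖Complex.exp (y * Complex.I) - 1 - y * Complex.I + y ^ 2 / 2‖
        ≤ 1 + 1 + |y| + y ^ 2 / 2 := by
      refine (norm_add_le _ _).trans ?_
      refine add_le_add ((norm_sub_le _ _).trans (add_le_add ((norm_sub_le _ _).trans ?_) ?_)) ?_
      · rw [Complex.norm_exp_ofReal_mul_I]; simp
      · simp
      · simp
    have h2 : |y| ≤ y ^ 2 := by rw [← sq_abs y]; nlinarith
    have h3 : y ^ 2 ≤ |y| ^ 3 := by
      rw [← sq_abs y]
      exact pow_le_pow_right₀ h (by norm_num)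
    constructor <;> nlinarith

theorem abs_exp_neg_half_sub {v : ℝ} (hv : v ^ 2 ≤ 1) :
    |Real.exp (-v ^ 2 / 2) - (1 - v ^ 2 / 2)| ≤ v ^ 4 := by
  have h := Real.norm_exp_sub_one_sub_id_le (x := -v ^ 2 / 2) (by
    rw [Real.norm_eq_abs, abs_le]; constructor <;> nlinarith [sq_nonneg v])
  rw [Real.norm_eq_abs, Real.norm_eq_abs, sq_abs] at h
  have e : Real.exp (-v ^ 2 / 2) - 1 - -v ^ 2 / 2 = Real.exp (-v ^ 2 / 2) - (1 - v ^ 2 / 2) := by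
    ring
  rw [e] at h
  nlinarith [sq_nonneg (v ^ 2)]

section ErrorField

variable {d : ℕ} {Ω : Type*} [MeasurableSpace Ω] {P : Measure Ω}
  {ε : Lattice d → Ω → ℝ}

theorem IsErrorField.integral_sq (hε : IsErrorField ε P) (j : Lattice d) :
    ∫ ω, ε j ω ^ 2 ∂P = 1 := by
  have h := variance_of_integral_eq_zero (hε.measurable j).aemeasurable (hε.mean_zero j)
  rw [hε.variance_one j] at h
  exact h.symm

theorem IsErrorField.integrable_sq (hε : IsErrorField ε P) (j : Lattice d) :
    Integrable (fun ω => ε j ω ^ 2) P :=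
  (hε.memLp j).integrable_sq

variable [IsProbabilityMeasure P]

/-- Near the origin the characteristic functions of the errors are uniformly close to the Gaussian
one. -/
theorem IsErrorField.charFun_approx (hε : IsErrorField ε P) {κ : ℝ} (hκ : 0 < κ) :
    ∃ τ : ℝ, 0 < τ ∧ ∀ (j : Lattice d) (v : ℝ), |v| ≤ τ →
      ‖charFun (P.map (ε j)) v - Real.exp (-v ^ 2 / 2)‖ ≤ κ * v ^ 2 := by
  -- Error budget: the Taylor remainder is `4v²ε²` on the tail `ε² ≥ C`, of mean at most `κ/4 · v²`,
  -- and `4|v|³|ε|³ ≤ 4|v|³Dε²` elsewhere, of mean at most `κ/4 · v²`. The last `κ/2 · v²` pays for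
  -- expanding the Gaussian factor; the `+ 1` in `D + 1` yields `|v| ≤ κ/16` for this.
  obtain ⟨C, hC⟩ := hε.unifIntegrable_sq.spec one_ne_zero ENNReal.one_ne_top
    (ε := κ / 16) (by positivity)
  set D : ℝ := Real.sqrt C with hD
  have hD0 : 0 ≤ D := Real.sqrt_nonneg _
  refine ⟨min 1 (κ / (16 * (D + 1))), by positivity, fun j v hv => ?_⟩
  have hv1 : |v| ≤ 1 := hv.trans (min_le_left _ _)
  have hv2 : |v| * (16 * (D + 1)) ≤ κ := by
    have := hv.trans (min_le_right _ _)
    rwa [le_div_iff₀ (by positivity)] at this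
  have hvv : v ^ 2 ≤ 1 := by rw [← sq_abs]; exact pow_le_one₀ (abs_nonneg _) hv1
  set S : Set Ω := {ω | C ≤ ‖ε j ω ^ 2‖₊} with hS
  have hSm : MeasurableSet S := measurableSet_le measurable_const
    ((hε.measurable j).pow_const 2).nnnorm
  have htail : ∫ ω, S.indicator (fun ω => ε j ω ^ 2) ω ∂P ≤ κ / 16 := by
    have h1 := hC j
    rw [eLpNorm_one_eq_lintegral_enorm] at h1
    have h2 : ∫ ω, S.indicator (fun ω => ε j ω ^ 2) ω ∂P
        = (∫⁻ ω, ENNReal.ofReal (S.indicator (fun ω => ε j ω ^ 2) ω) ∂P).toReal :=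
      integral_eq_lintegral_of_nonneg_ae
        (Eventually.of_forall fun ω => Set.indicator_nonneg (fun _ _ => sq_nonneg _) ω)
        ((hε.integrable_sq j).indicator hSm).aestronglyMeasurable
    rw [h2]
    refine ENNReal.toReal_le_of_le_ofReal (by positivity) (le_trans (lintegral_mono fun ω => ?_) h1)
    exact Real.ofReal_le_enorm _
  have hint1 : Integrable (fun ω => Complex.exp ((v * ε j ω : ℝ) * Complex.I)) P := by
    refine (integrable_const (1 : ℝ)).mono' ?_ (Eventually.of_forall fun ω => ?_)
    · have := hε.measurable j
      exact (by fun_prop : Measurable _).aestronglyMeasurable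
    · rw [Complex.norm_exp_ofReal_mul_I]
  have hintε : Integrable (ε j) P := (hε.memLp j).integrable one_le_two
  have hint2 : Integrable (fun ω => ((v * ε j ω : ℝ) : ℂ) * Complex.I) P :=
    ((hintε.const_mul v).ofReal).mul_const _
  have hint3 : Integrable (fun ω => ((v * ε j ω : ℝ) : ℂ) ^ 2 / 2) P := by
    have : Integrable (fun ω => (((v ^ 2 / 2) * ε j ω ^ 2 : ℝ) : ℂ)) P :=
      ((hε.integrable_sq j).const_mul (v ^ 2 / 2)).ofReal
    refine this.congr (Eventually.of_forall fun ω => ?_)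
    simp only
    push_cast
    ring
  have hcf : charFun (P.map (ε j)) v - (1 - v ^ 2 / 2 : ℝ)
      = ∫ ω, (Complex.exp ((v * ε j ω : ℝ) * Complex.I) - 1 - (v * ε j ω : ℝ) * Complex.I
          + ((v * ε j ω : ℝ) : ℂ) ^ 2 / 2) ∂P := by
    have hint4 : Integrable (fun ω => Complex.exp ((v * ε j ω : ℝ) * Complex.I) - 1) P :=
      hint1.sub (integrable_const _)
    have hint5 : Integrable (fun ω => Complex.exp ((v * ε j ω : ℝ) * Complex.I) - 1
        - (v * ε j ω : ℝ) * Complex.I) P := hint4.sub hint2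
    rw [integral_add hint5 hint3, integral_sub hint4 hint2, integral_sub hint1 (integrable_const _)]
    rw [charFun_apply_real, integral_map (hε.measurable j).aemeasurable
      (by exact (by fun_prop : Measurable _).aestronglyMeasurable)]
    have e2 : ∫ ω, ((v * ε j ω : ℝ) : ℂ) * Complex.I ∂P = 0 := by
      rw [integral_mul_const, integral_complex_ofReal, integral_const_mul, hε.mean_zero j]
      simp
    have e3 : ∫ ω, ((v * ε j ω : ℝ) : ℂ) ^ 2 / 2 ∂P = ((v ^ 2 / 2 : ℝ) : ℂ) := by
      have : ∀ ω, ((v * ε j ω : ℝ) : ℂ) ^ 2 / 2 = (((v ^ 2 / 2) * ε j ω ^ 2 : ℝ) : ℂ) := by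
        intro ω; push_cast; ring
      simp_rw [this]
      rw [integral_complex_ofReal, integral_const_mul, hε.integral_sq j, mul_one]
    rw [e2, e3]
    simp
    ring
  have hbd : ‖charFun (P.map (ε j)) v - (1 - v ^ 2 / 2 : ℝ)‖ ≤ κ / 2 * v ^ 2 := by
    rw [hcf]
    refine (norm_integral_le_of_norm_le (g := fun ω =>
      4 * v ^ 2 * S.indicator (fun ω => ε j ω ^ 2) ω + 4 * |v| ^ 3 * D * ε j ω ^ 2)
      (((hε.integrable_sq j).indicator hSm |>.const_mul _).add
        ((hε.integrable_sq j).const_mul _)) (Eventually.of_forall fun ω => ?_)).trans ?_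
    · obtain ⟨h2, h3⟩ := norm_exp_mul_I_taylor_two (v * ε j ω)
      by_cases hω : ω ∈ S
      · rw [Set.indicator_of_mem hω]
        refine h2.trans ?_
        have : 0 ≤ 4 * |v| ^ 3 * D * ε j ω ^ 2 := by positivity
        nlinarith
      · rw [Set.indicator_of_notMem hω]
        refine h3.trans ?_
        have hlt : |ε j ω| ≤ D := by
          rw [hD]
          refine Real.abs_le_sqrt ?_
          have : ‖ε j ω ^ 2‖₊ < C := not_le.1 hω
          have h' : ‖ε j ω ^ 2‖ < C := by exact_mod_cast this
          rw [Real.norm_eq_abs, abs_of_nonneg (sq_nonneg _)] at h'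
          exact h'.le
        rw [abs_mul, mul_pow]
        have h4 : |ε j ω| ^ 3 ≤ D * ε j ω ^ 2 := by
          rw [← sq_abs (ε j ω), pow_succ' |ε j ω| 2]
          gcongr
        have h5 : 0 ≤ |v| ^ 3 := by positivity
        nlinarith [mul_le_mul_of_nonneg_left h4 h5]
    · rw [integral_add ((hε.integrable_sq j).indicator hSm |>.const_mul _)
        ((hε.integrable_sq j).const_mul _), integral_const_mul, integral_const_mul,
        hε.integral_sq j]
      have h6 : |v| ^ 3 = |v| * v ^ 2 := by rw [pow_succ' |v| 2, sq_abs]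
      rw [h6]
      have h7 : 4 * v ^ 2 * ∫ ω, S.indicator (fun ω => ε j ω ^ 2) ω ∂P ≤ 4 * v ^ 2 * (κ / 16) := by
        gcongr
      have h8 : |v| * D ≤ κ / 16 := by nlinarith [abs_nonneg v]
      have h9 : |v| * D * v ^ 2 ≤ κ / 16 * v ^ 2 := by gcongr
      nlinarith
  have hexp := abs_exp_neg_half_sub hvv
  have hv4 : v ^ 4 ≤ κ / 2 * v ^ 2 := by
    have h1 : v ^ 2 ≤ κ / 2 := by
      rw [← sq_abs]
      nlinarith [abs_nonneg v]
    nlinarith [sq_nonneg v]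
  calc ‖charFun (P.map (ε j)) v - Real.exp (-v ^ 2 / 2)‖
      = ‖(charFun (P.map (ε j)) v - (1 - v ^ 2 / 2 : ℝ))
          - ((Real.exp (-v ^ 2 / 2) - (1 - v ^ 2 / 2) : ℝ) : ℂ)‖ := by
        congr 1; push_cast; ring
    _ ≤ κ / 2 * v ^ 2 + κ / 2 * v ^ 2 := by
        refine (norm_sub_le _ _).trans (add_le_add hbd ?_)
        rw [Complex.norm_real, Real.norm_eq_abs]
        exact hexp.trans hv4
    _ = κ * v ^ 2 := by ring

/-- Telescoping: exchange one factor at a time, all the others having norm at most one. -/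
theorem norm_prod_sub_prod_le_sum {ι : Type*} (s : Finset ι) (f g : ι → ℂ)
    (hf : ∀ i ∈ s, ‖f i‖ ≤ 1) (hg : ∀ i ∈ s, ‖g i‖ ≤ 1) :
    ‖∏ i ∈ s, f i - ∏ i ∈ s, g i‖ ≤ ∑ i ∈ s, ‖f i - g i‖ := by
  classical
  induction s using Finset.induction_on with
  | empty => simp
  | insert a s ha ih =>
    rw [Finset.prod_insert ha, Finset.prod_insert ha, Finset.sum_insert ha]
    have hP : ‖∏ i ∈ s, f i‖ ≤ 1 := by
      rw [norm_prod]
      exact Finset.prod_le_one (fun _ _ => norm_nonneg _)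
        fun i hi => hf i (Finset.mem_insert_of_mem hi)
    have h1 := ih (fun i hi => hf i (Finset.mem_insert_of_mem hi))
      (fun i hi => hg i (Finset.mem_insert_of_mem hi))
    have e : f a * ∏ i ∈ s, f i - g a * ∏ i ∈ s, g i
        = (f a - g a) * ∏ i ∈ s, f i + g a * (∏ i ∈ s, f i - ∏ i ∈ s, g i) := by ring
    rw [e]
    refine (norm_add_le _ _).trans (add_le_add ?_ ?_)
    · rw [norm_mul]
      exact mul_le_of_le_one_right (norm_nonneg _) hP
    · rw [norm_mul]
      exact (mul_le_of_le_one_left (norm_nonneg _) (hg a (Finset.mem_insert_self _ _))).trans h1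

/-- Characteristic functions are Lipschitz in the `L²` distance of random variables. -/
theorem norm_charFun_map_sub_le {X Y : Ω → ℝ} (hX : MemLp X 2 P) (hY : MemLp Y 2 P) (u : ℝ) :
    ‖charFun (P.map X) u - charFun (P.map Y) u‖
      ≤ |u| * (eLpNorm (fun ω => X ω - Y ω) 2 P).toReal := by
  have hm : ∀ {W : Ω → ℝ}, MemLp W 2 P →
      Integrable (fun ω => Complex.exp ((u * W ω : ℝ) * Complex.I)) P := by
    intro W hW
    refine (integrable_const (1 : ℝ)).mono' ?_ (Eventually.of_forall fun ω => ?_)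
    · have := hW.aestronglyMeasurable.aemeasurable
      exact (by fun_prop : AEMeasurable _ P).aestronglyMeasurable
    · rw [Complex.norm_exp_ofReal_mul_I]
  have hc : ∀ {W : Ω → ℝ}, MemLp W 2 P →
      charFun (P.map W) u = ∫ ω, Complex.exp ((u * W ω : ℝ) * Complex.I) ∂P := by
    intro W hW
    rw [charFun_apply_real, integral_map hW.aestronglyMeasurable.aemeasurable
      (by exact (by fun_prop : Measurable _).aestronglyMeasurable)]
    simp
  have hXY : MemLp (fun ω => X ω - Y ω) 2 P := hX.sub hY
  have hXY1 : MemLp (fun ω => X ω - Y ω) 1 P := hXY.mono_exponent one_le_two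
  rw [hc hX, hc hY, ← integral_sub (hm hX) (hm hY)]
  refine (norm_integral_le_of_norm_le (g := fun ω => |u| * ‖X ω - Y ω‖)
    ((memLp_one_iff_integrable.1 hXY1).norm.const_mul _)
    (Eventually.of_forall fun ω => ?_)).trans ?_
  · have e : Complex.exp ((u * X ω : ℝ) * Complex.I) - Complex.exp ((u * Y ω : ℝ) * Complex.I)
        = Complex.exp ((u * Y ω : ℝ) * Complex.I)
          * (Complex.exp (Complex.I * (u * (X ω - Y ω) : ℝ)) - 1) := by
      rw [mul_sub, ← Complex.exp_add, mul_one]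
      congr 2
      push_cast
      ring
    rw [e, norm_mul, Complex.norm_exp_ofReal_mul_I, one_mul]
    refine Real.norm_exp_I_mul_ofReal_sub_one_le.trans ?_
    rw [norm_mul, Real.norm_eq_abs]
  · rw [integral_const_mul]
    refine mul_le_mul_of_nonneg_left ?_ (abs_nonneg _)
    rw [integral_norm_eq_lintegral_enorm hXY1.aestronglyMeasurable,
      ← eLpNorm_one_eq_lintegral_enorm]
    exact ENNReal.toReal_mono hXY.eLpNorm_ne_top
      (eLpNorm_le_eLpNorm_of_exponent_le one_le_two hXY.aestronglyMeasurable)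

/-- By independence both terms are products over `s`, so they can be compared factor by factor. The
constant does not depend on `s`, so the bound survives the passage to an infinite sum. -/
theorem norm_charFun_weighted_sum_sub_le (hε : IsErrorField ε P) {κ τ u : ℝ}
    (happ : ∀ (j : Lattice d) (v : ℝ), |v| ≤ τ →
      ‖charFun (P.map (ε j)) v - Real.exp (-v ^ 2 / 2)‖ ≤ κ * v ^ 2)
    (b : Lattice d → ℝ) (hb : ∀ j, |b j * u| ≤ τ) (s : Finset (Lattice d)) :
    ‖charFun (P.map (fun ω => ∑ j ∈ s, b j * ε j ω)) u
      - Real.exp (-(u ^ 2 * ∑ j ∈ s, b j ^ 2) / 2)‖ ≤ κ * u ^ 2 * ∑ j ∈ s, b j ^ 2 := by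
  have hind : iIndepFun (fun j ω => b j * ε j ω) P :=
    hε.indep.comp (fun j x => b j * x) fun j => measurable_const_mul _
  have h1 : charFun (P.map (fun ω => ∑ j ∈ s, b j * ε j ω)) u
      = ∏ j ∈ s, charFun (P.map (ε j)) (b j * u) := by
    rw [(hind.restrict _).charFun_map_fun_finsetSum_eq_prod
      fun j _ => ((hε.measurable j).const_mul _).aemeasurable, Finset.prod_apply]
    refine Finset.prod_congr rfl fun j _ => ?_
    rw [charFun_map_mul_comp (hε.measurable j).aemeasurable]
  have h2 : ((Real.exp (-(u ^ 2 * ∑ j ∈ s, b j ^ 2) / 2) : ℝ) : ℂ)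
      = ∏ j ∈ s, ((Real.exp (-(b j * u) ^ 2 / 2) : ℝ) : ℂ) := by
    rw [← Complex.ofReal_prod, ← Real.exp_sum]
    congr 2
    rw [Finset.mul_sum, ← Finset.sum_neg_distrib, Finset.sum_div]
    exact Finset.sum_congr rfl fun j _ => by ring
  rw [h1, h2]
  refine (norm_prod_sub_prod_le_sum s _ _ (fun j _ => ?_) (fun j _ => ?_)).trans ?_
  · have := Measure.isProbabilityMeasure_map (μ := P) (hε.measurable j).aemeasurable
    exact norm_charFun_le_one _
  · rw [Complex.norm_real, Real.norm_eq_abs, Real.abs_exp]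
    exact Real.exp_le_one_iff.2 (by nlinarith [sq_nonneg (b j * u)])
  · rw [Finset.mul_sum]
    refine Finset.sum_le_sum fun j _ => (happ j _ (hb j)).trans (le_of_eq ?_)
    ring

/-- The central limit theorem for `L²` limits of weighted sums of the errors, whose weights are
uniformly small and have convergent sums of squares. -/
theorem tendstoInDistribution_of_weights (hε : IsErrorField ε P) (X : ℕ → Ω → ℝ)
    (hX : ∀ n, MemLp (X n) 2 P) (b : ℕ → Lattice d → ℝ)
    (hXb : ∀ n, Tendsto (fun s : Finset (Lattice d) =>
      eLpNorm (fun ω => X n ω - ∑ j ∈ s, b n j * ε j ω) 2 P) atTop (𝓝 0))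
    (hsum : ∀ n, Summable fun j => b n j ^ 2) (c : ℕ → ℝ) (hbc : ∀ n j, |b n j| ≤ c n)
    (hc : Tendsto c atTop (𝓝 0)) {V : ℝ} (hV : Tendsto (fun n => ∑' j, b n j ^ 2) atTop (𝓝 V)) :
    TendstoInDistribution X atTop (id : ℝ → ℝ) (fun _ => P) (gaussianReal 0 V.toNNReal) := by
  have hV0 : 0 ≤ V := ge_of_tendsto' hV fun n => tsum_nonneg fun j => sq_nonneg _
  refine ⟨fun n => (hX n).aestronglyMeasurable.aemeasurable, aemeasurable_id, ?_⟩
  refine ProbabilityMeasure.tendsto_iff_tendsto_charFun.2 fun u => ?_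
  simp only [ProbabilityMeasure.coe_mk, Measure.map_id, charFun_gaussianReal]
  have hlim : Complex.exp (u * (0 : ℝ) * Complex.I - (V.toNNReal : ℝ) * u ^ 2 / 2)
      = (Real.exp (-(u ^ 2 * V) / 2) : ℝ) := by
    rw [Real.coe_toNNReal _ hV0]
    push_cast
    congr 1
    ring
  have hgauss : Tendsto (fun n => ((Real.exp (-(u ^ 2 * ∑' j, b n j ^ 2) / 2) : ℝ) : ℂ)) atTop
      (𝓝 (Real.exp (-(u ^ 2 * V) / 2) : ℝ)) := by
    refine (Complex.continuous_ofReal.tendsto _).comp ?_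
    refine (Real.continuous_exp.tendsto _).comp ?_
    exact ((hV.const_mul (u ^ 2)).neg).div_const 2
  rw [hlim]
  have hdiff : Tendsto (fun n => charFun (P.map (X n)) u
      - ((Real.exp (-(u ^ 2 * ∑' j, b n j ^ 2) / 2) : ℝ) : ℂ)) atTop (𝓝 0) := by
    rw [Metric.tendsto_atTop']
    intro η hη
    -- `V + 1` eventually bounds the sum of squares; the outer `+ 1` makes the final inequality
    -- strict.
    set κ : ℝ := η / (2 * (u ^ 2 * (V + 1) + 1)) with hκ
    have hκ0 : 0 < κ := by positivity
    obtain ⟨τ, hτ, happ⟩ := hε.charFun_approx hκ0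
    have hcu : Tendsto (fun n => c n * |u|) atTop (𝓝 0) := by simpa using hc.mul_const |u|
    obtain ⟨N, hN⟩ := eventually_atTop.1
      ((hcu.eventually_le_const hτ).and (hV.eventually_le_const (show V < V + 1 by linarith)))
    refine ⟨N, fun n hn => ?_⟩
    obtain ⟨hn1, hn2⟩ := hN n hn.le
    have hbu : ∀ j, |b n j * u| ≤ τ := fun j => by
      rw [abs_mul]
      exact (mul_le_mul_of_nonneg_right (hbc n j) (abs_nonneg _)).trans hn1
    have hle : ‖charFun (P.map (X n)) u
        - ((Real.exp (-(u ^ 2 * ∑' j, b n j ^ 2) / 2) : ℝ) : ℂ)‖ ≤ κ * u ^ 2 * ∑' j, b n j ^ 2 := by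
      have hW : ∀ s : Finset (Lattice d), MemLp (fun ω => ∑ j ∈ s, b n j * ε j ω) 2 P := fun s =>
        memLp_finsetSum s fun j _ => (hε.memLp j).const_mul _
      have t1 : Tendsto (fun s : Finset (Lattice d) => ∑ j ∈ s, b n j ^ 2) atTop
        (𝓝 (∑' j, b n j ^ 2)) := (hsum n).hasSum
      have t2 : Tendsto (fun s : Finset (Lattice d) =>
          charFun (P.map (fun ω => ∑ j ∈ s, b n j * ε j ω)) u) atTop
          (𝓝 (charFun (P.map (X n)) u)) := by
        rw [tendsto_iff_norm_sub_tendsto_zero]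
        refine squeeze_zero (fun _ => norm_nonneg _)
          (fun s => (norm_sub_rev _ _).le.trans (norm_charFun_map_sub_le (hX n) (hW s) u)) ?_
        have := ((ENNReal.tendsto_toReal ENNReal.zero_ne_top).comp (hXb n)).const_mul |u|
        simpa using this
      have t3 : Tendsto (fun s : Finset (Lattice d) =>
          ((Real.exp (-(u ^ 2 * ∑ j ∈ s, b n j ^ 2) / 2) : ℝ) : ℂ)) atTop
          (𝓝 (Real.exp (-(u ^ 2 * ∑' j, b n j ^ 2) / 2) : ℝ)) := by
        refine (Complex.continuous_ofReal.tendsto _).comp ?_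
        refine (Real.continuous_exp.tendsto _).comp ?_
        exact ((t1.const_mul (u ^ 2)).neg).div_const 2
      exact le_of_tendsto_of_tendsto' (t2.sub t3).norm (t1.const_mul _)
        fun s => norm_charFun_weighted_sum_sub_le hε happ (b n) hbu s
    rw [dist_zero_right]
    refine hle.trans_lt ?_
    have h1 : κ * u ^ 2 * ∑' j, b n j ^ 2 ≤ κ * (u ^ 2 * (V + 1)) := by
      rw [mul_assoc]
      gcongr
    have h2 : κ * (u ^ 2 * (V + 1) + 1) = η / 2 := by
      rw [hκ]
      field_simp
    nlinarith
  simpa using hdiff.add hgauss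

end ErrorField

/-! ### Slowly varying functions -/

/-- Turns the supremum condition into a usable inequality on one dyadic window; the local
boundedness of `L` ensures that the `sSup` is a genuine supremum. -/
theorem SlowlyVarying.exists_local_bound {L : ℝ → ℝ} (hL : SlowlyVarying L) {c : ℝ} (hc : 1 < c) :
    ∃ T : ℝ, 1 ≤ T ∧ ∀ t, T ≤ t → 0 < L t ∧
      ∀ a, 1 / 2 ≤ a → a ≤ 2 → L (a * t) ≤ c * L t := by
  have h := hL.tendsto (1 / 2) 2 (by norm_num) (by norm_num)
  obtain ⟨T, hT⟩ := eventually_atTop.1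
    ((h.eventually_lt_const hc).and (h.eventually_const_lt (show (0 : ℝ) < 1 by norm_num)))
  refine ⟨max T 1, le_max_right _ _, fun t ht => ?_⟩
  have ht1 : 1 ≤ t := (le_max_right _ _).trans ht
  obtain ⟨h1, h2⟩ := hT t ((le_max_left _ _).trans ht)
  have hpos : 0 < L t := by
    rcases (hL.nonneg t (by linarith)).lt_or_eq with h0 | h0
    · exact h0
    · exfalso
      -- If `L t = 0`, all the ratios are `0` by the convention for division, so the supremum would
      -- be `0` instead of close to `1`.
      rw [← h0] at h2
      have : (fun a : ℝ => L (a * t) / 0) '' Set.Icc (1 / 2) 2 = {0} := by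
        simp only [div_zero]
        exact (Set.nonempty_Icc.2 (by norm_num)).image_const 0
      rw [this] at h2
      simp at h2
  refine ⟨hpos, fun a ha1 ha2 => ?_⟩
  obtain ⟨K, hK⟩ := hL.bounded (2 * t) (by linarith)
  have hbdd : BddAbove ((fun a : ℝ => L (a * t) / L t) '' Set.Icc (1 / 2) 2) := by
    refine ⟨K / L t, ?_⟩
    rintro _ ⟨b, ⟨hb1, hb2⟩, rfl⟩
    simp only
    gcongr
    exact hK _ (by nlinarith) (by nlinarith)
  have h3 : L (a * t) / L t ≤ c := (le_csSup hbdd ⟨a, ⟨ha1, ha2⟩, rfl⟩).trans h1.le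
  rwa [div_le_iff₀ hpos] at h3

/-- Potter's bounds for a slowly varying function. -/
theorem SlowlyVarying.potter {L : ℝ → ℝ} (hL : SlowlyVarying L) {δ : ℝ} (hδ : 0 < δ) :
    ∃ C T : ℝ, 1 ≤ C ∧ 1 ≤ T ∧ ∀ s, T ≤ s → 0 < L s ∧ ∀ t, s ≤ t →
      L t ≤ C * (t / s) ^ δ * L s ∧ L s ≤ C * (t / s) ^ δ * L t := by
  have hc : (1 : ℝ) < 2 ^ δ := Real.one_lt_rpow (by norm_num) hδ
  obtain ⟨T, hT1, hT⟩ := hL.exists_local_bound hc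
  refine ⟨2 ^ δ, T, hc.le, hT1, fun s hs => ⟨(hT s hs).1, fun t hst => ?_⟩⟩
  have hs0 : 0 < s := by linarith
  -- Chaining over dyadic scales: each halving of `t` costs one factor `2 ^ δ`, and when `t / 2 < s`
  -- a single comparison of `t` with `s` suffices.
  have key : ∀ (k : ℕ) (t : ℝ), s ≤ t → t ≤ 2 ^ k * s →
      L t ≤ (2 ^ δ) ^ k * L s ∧ L s ≤ (2 ^ δ) ^ k * L t := by
    intro k
    induction k with
    | zero =>
      intro t h1 h2
      have : t = s := le_antisymm (by simpa using h2) h1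
      simp [this]
    | succ k ih =>
      intro t h1 h2
      have ht := (hT t (hs.trans h1)).1
      have hpos := (hT s hs).1
      have hck : (0 : ℝ) < (2 ^ δ) ^ k := by positivity
      rcases le_total t (2 ^ k * s) with h3 | h3
      · obtain ⟨i1, i2⟩ := ih t h1 h3
        have hmono : ((2 : ℝ) ^ δ) ^ k ≤ (2 ^ δ) ^ (k + 1) :=
          pow_le_pow_right₀ hc.le (Nat.le_succ k)
        exact ⟨i1.trans (by gcongr), i2.trans (by gcongr)⟩
      · rcases le_total s (t / 2) with h4 | h4
        · obtain ⟨i1, i2⟩ := ih (t / 2) h4 (by rw [pow_succ] at h2; linarith)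
          have j1 := (hT (t / 2) (hs.trans h4)).2 2 (by norm_num) le_rfl
          have j2 := (hT t (hs.trans h1)).2 (1 / 2) le_rfl (by norm_num)
          rw [show 2 * (t / 2) = t by ring] at j1
          rw [show 1 / 2 * t = t / 2 by ring] at j2
          rw [pow_succ]
          constructor
          · nlinarith
          · nlinarith
        · have j1 := (hT s hs).2 (t / s) (by rw [le_div_iff₀ hs0]; linarith)
            (by rw [div_le_iff₀ hs0]; linarith)
          have j2 := (hT t (hs.trans h1)).2 (s / t)
            (by rw [le_div_iff₀ (by linarith)]; linarith)
            (by rw [div_le_iff₀ (by linarith)]; linarith)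
          rw [div_mul_cancel₀ _ hs0.ne'] at j1
          rw [div_mul_cancel₀ _ (by linarith : t ≠ 0)] at j2
          have hmono : (2 : ℝ) ^ δ ≤ (2 ^ δ) ^ (k + 1) := le_self_pow₀ hc.le (Nat.succ_ne_zero k)
          exact ⟨j1.trans (by gcongr), j2.trans (by gcongr)⟩
  have hx1 : 1 ≤ t / s := (one_le_div hs0).2 hst
  -- With `2 ^ k ≤ t / s < 2 ^ (k + 1)`, the `k + 1` factors `2 ^ δ` amount to at most `2 ^ δ (t /
  -- s) ^ δ`.
  obtain ⟨k, hk1, hk2⟩ := exists_nat_pow_near hx1 (show (1 : ℝ) < 2 by norm_num)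
  have hk3 : t ≤ 2 ^ (k + 1) * s := by
    rw [div_lt_iff₀ hs0] at hk2
    exact hk2.le
  have hle : ((2 : ℝ) ^ δ) ^ (k + 1) ≤ 2 ^ δ * (t / s) ^ δ := by
    rw [pow_succ']
    gcongr
    rw [← Real.rpow_natCast, ← Real.rpow_mul (by norm_num), mul_comm, Real.rpow_mul (by norm_num),
      Real.rpow_natCast]
    exact Real.rpow_le_rpow (by positivity) hk1 hδ.le
  obtain ⟨i1, i2⟩ := key (k + 1) t hst hk3
  have ht := (hT t (hs.trans hst)).1
  have hpos := (hT s hs).1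
  exact ⟨i1.trans (by gcongr), i2.trans (by gcongr)⟩

/-! ### Lattice sums as integrals over cells -/

section Cells

variable {d : ℕ}

theorem toSpace_apply (i : Lattice d) (k : Fin d) : toSpace i k = (i k : ℝ) := rfl

theorem toSpace_add (i j : Lattice d) : toSpace (i + j) = toSpace i + toSpace j := by
  ext k
  simp [toSpace_apply]

theorem floorVec_toSpace (i : Lattice d) : floorVec (toSpace i) = i := by
  funext k
  simp [floorVec, toSpace_apply]

theorem norm_toSpace_floorVec_sub_le (x : Space d) :
    ‖toSpace (floorVec x) - x‖ ≤ Real.sqrt d := by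
  rw [EuclideanSpace.norm_eq]
  refine Real.sqrt_le_sqrt ?_
  calc ∑ k, ‖(toSpace (floorVec x) - x) k‖ ^ 2 ≤ ∑ _k : Fin d, (1 : ℝ) := by
        refine Finset.sum_le_sum fun k _ => ?_
        rw [Real.norm_eq_abs, sq_abs]
        have h1 : (toSpace (floorVec x) - x) k = (⌊x k⌋ : ℝ) - x k := rfl
        have h2 := Int.floor_le (x k)
        have h3 := Int.lt_floor_add_one (x k)
        rw [h1]
        nlinarith
    _ = d := by simp

theorem measurable_floorVec : Measurable (floorVec : Space d → Lattice d) :=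
  measurable_pi_iff.2 fun k => Int.measurable_floor.comp (by fun_prop)

theorem measurable_floorVec_smul (c : ℝ) : Measurable fun x : Space d => floorVec (c • x) :=
  measurable_floorVec.comp (measurable_const_smul c)

theorem volume_floorVec_preimage (j : Lattice d) :
    volume (floorVec ⁻¹' {j} : Set (Space d)) = 1 := by
  have h := (PiLp.volume_preserving_toLp (Fin d)).measure_preimage
    (s := (floorVec ⁻¹' {j} : Set (Space d)))
    (measurable_floorVec (measurableSet_singleton j)).nullMeasurableSet
  rw [← h]
  have e : WithLp.toLp 2 ⁻¹' (floorVec ⁻¹' {j} : Set (Space d))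
      = Set.univ.pi fun k => Set.Ico (j k : ℝ) (j k + 1) := by
    ext x
    simp only [Set.mem_preimage, Set.mem_singleton_iff, Set.mem_pi, Set.mem_univ, true_implies,
      Set.mem_Ico, funext_iff, floorVec, Int.floor_eq_iff]
  rw [e, volume_pi_pi]
  simp

/-- Each lattice point receives one cube of side `1 / c`. This makes lattice sums exact integrals of
step functions, with no Riemann sum error. -/
theorem map_floorVec_smul {c : ℝ} (hc : 0 < c) :
    Measure.map (fun x : Space d => floorVec (c • x)) volume
      = ENNReal.ofReal ((c ^ d)⁻¹) • Measure.count := by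
  refine Measure.ext_of_singleton fun j => ?_
  rw [Measure.map_apply (measurable_floorVec_smul c) (measurableSet_singleton j)]
  have : (fun x : Space d => floorVec (c • x)) ⁻¹' {j}
      = (fun x : Space d => c • x) ⁻¹' (floorVec ⁻¹' {j}) := rfl
  rw [this, Measure.addHaar_preimage_smul _ hc.ne', volume_floorVec_preimage]
  simp [abs_of_pos hc]

theorem integrable_floorVec_smul {c : ℝ} (hc : 0 < c) {F : Lattice d → ℝ} (hF : Summable F) :
    Integrable fun x : Space d => F (floorVec (c • x)) := by
  have h := (integrable_map_measure (μ := (volume : Measure (Space d))) (g := F)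
    (f := fun x : Space d => floorVec (c • x))
    (measurable_of_countable F).aestronglyMeasurable (measurable_floorVec_smul c).aemeasurable).1
  refine h ?_
  rw [map_floorVec_smul hc]
  exact (integrable_count_iff.2 hF.norm).smul_measure ENNReal.ofReal_ne_top

theorem integral_floorVec_smul {c : ℝ} (hc : 0 < c) {F : Lattice d → ℝ} (hF : Summable F) :
    ∫ x : Space d, F (floorVec (c • x)) = (c ^ d)⁻¹ * ∑' j, F j := by
  have h := integral_map (μ := (volume : Measure (Space d))) (f := F)
    (measurable_floorVec_smul c).aemeasurable (measurable_of_countable F).aestronglyMeasurable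
  rw [← h, map_floorVec_smul hc, integral_smul_measure,
    integral_countable (integrable_count_iff.2 hF.norm)]
  simp [ENNReal.toReal_ofReal (inv_nonneg.2 (pow_nonneg hc.le d))]

end Cells

/-! ### The coefficients -/

section Coefficients

variable {d : ℕ} {α : Lattice d → ℝ} {β : ℝ} {L : ℝ → ℝ} {g : Space d → ℝ}

/-- The shifted lattice sites `m` for which `(m + j) / c` lies in `U`. -/
def shiftedSites (U : Set (Space d)) (c : ℝ) (j : Lattice d) : Set (Lattice d) :=
  {m | c⁻¹ • toSpace (m + j) ∈ U}

/-- The sum of the coefficients `α(i - j)` over the lattice points `i` with `i / c ∈ U`. -/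
def shiftSum (α : Lattice d → ℝ) (U : Set (Space d)) (c : ℝ) (j : Lattice d) : ℝ :=
  ∑' m, (shiftedSites U c j).indicator α m

/-- The direction `m / ‖m‖` is admissible at radius `‖m‖`, and rounding is exact at a lattice point.
Summability bounds the set whose `sSup` is taken. -/
theorem abs_le_radialMax (hα : Summable α) {m : Lattice d} (hm : toSpace m ≠ 0) :
    |α m| ≤ radialMax α ‖toSpace m‖ := by
  have hn : ‖toSpace m‖ ≠ 0 := norm_ne_zero_iff.2 hm
  refine le_csSup ⟨∑' i, |α i|, ?_⟩ ⟨‖toSpace m‖⁻¹ • toSpace m, ?_, ?_⟩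
  · rintro _ ⟨u, -, rfl⟩
    exact hα.abs.le_tsum _ fun _ _ => abs_nonneg _
  · rw [norm_smul, norm_inv, norm_norm, inv_mul_cancel₀ hn]
  · rw [smul_inv_smul₀ hn, floorVec_toSpace]

theorem integrable_scaledCoeff (hα : Summable α) {t : ℝ} (ht : 0 < t) :
    Integrable (scaledCoeff α t) :=
  (integrable_floorVec_smul ht hα).div_const _

theorem SpatialLimit.tendsto_enorm (hg : SpatialLimit α β g) (hβ : (d : ℝ) < β) {δ : ℝ}
    (hδ : 0 < δ) :
    Tendsto (fun t : ℝ => ∫⁻ x in {x : Space d | δ ≤ ‖x‖}, ‖scaledCoeff α t x - g x‖ₑ)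
      atTop (𝓝 0) := by
  have h := hg.tendsto δ hδ
  have hb : limitExponent d β = 1 := if_neg (not_le.2 hβ)
  simpa only [hb, pow_one, ← Real.enorm_eq_ofReal_abs] using h

theorem measurableSet_le_norm (δ : ℝ) : MeasurableSet {x : Space d | δ ≤ ‖x‖} :=
  measurableSet_le measurable_const measurable_norm

/-- A single large `t` suffices: `g_t` is integrable and `g_t - g` has finite `L¹` norm off the
ball. -/
theorem SpatialLimit.integrableOn (hg : SpatialLimit α β g) (hα : Summable α) (hβ : (d : ℝ) < β)
    {δ : ℝ} (hδ : 0 < δ) : IntegrableOn g {x : Space d | δ ≤ ‖x‖} := by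
  obtain ⟨t, h1, ht⟩ := (((hg.tendsto_enorm hβ hδ).eventually_lt_const
    (show (0 : ℝ≥0∞) < 1 by norm_num)).and (eventually_gt_atTop 0)).exists
  have hs := (integrable_scaledCoeff hα ht).integrableOn (s := {x : Space d | δ ≤ ‖x‖})
  have hd : IntegrableOn (fun x => scaledCoeff α t x - g x) {x : Space d | δ ≤ ‖x‖} :=
    ⟨(hs.aestronglyMeasurable.sub hg.aemeasurable.aestronglyMeasurable.restrict),
      h1.trans ENNReal.one_lt_top⟩
  have := hs.sub hd
  refine this.congr_fun (fun x _ => ?_) (measurableSet_le_norm δ)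
  simp

theorem RegularDecay.radialMax_pos (hα : RegularDecay α β L) :
    ∀ᶠ t in atTop, 0 < radialMax α t := by
  obtain ⟨C, T, -, hT1, hT⟩ := hα.slowly.potter one_pos
  filter_upwards [eventually_ge_atTop T] with t ht
  rw [hα.eq t (by linarith)]
  exact mul_pos (Real.rpow_pos_of_pos (by linarith) _) (hT t ht).1

/-- The coefficients outside a large ball sum up to at most a multiple of `r ^ d γ(r)`. -/
theorem SpatialLimit.exists_tail_bound (hg : SpatialLimit α β g) (hα : Summable α)
    (hdecay : RegularDecay α β L) (hβ : (d : ℝ) < β) :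
    ∃ C T : ℝ, 0 ≤ C ∧ ∀ r, T ≤ r →
      ∑' m, {m : Lattice d | r ≤ ‖toSpace m‖}.indicator (fun m => |α m|) m
        ≤ C * (r ^ d * radialMax α r) := by
  set S : Set (Space d) := {x : Space d | 1 / 2 ≤ ‖x‖} with hS
  have hgS : IntegrableOn g S := hg.integrableOn hα hβ (by norm_num)
  have hev := (hg.tendsto_enorm hβ (show (0 : ℝ) < 1 / 2 by norm_num)).eventually_lt_const
    (show (0 : ℝ≥0∞) < 1 by norm_num)
  -- For `r ≥ 2√d` rounding moves a point by at most `r / 2`, so the scaled cells of all `m` with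
  -- `‖m‖ ≥ r` lie in `{‖x‖ ≥ 1/2}`. There the `L¹` norm of `g_r` is at most that of `g` plus one.
  obtain ⟨T, hT⟩ := eventually_atTop.1 ((hev.and hdecay.radialMax_pos).and
    ((eventually_ge_atTop (2 * Real.sqrt d)).and (eventually_gt_atTop 0)))
  refine ⟨1 + ∫ x in S, ‖g x‖, T, by positivity, fun r hr => ?_⟩
  obtain ⟨⟨h1, hγ⟩, h2, hr0⟩ := hT r hr
  have hsc : IntegrableOn (scaledCoeff α r) S := (integrable_scaledCoeff hα hr0).integrableOn
  have hdiff : IntegrableOn (fun x => scaledCoeff α r x - g x) S := hsc.sub hgS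
  have hM : ∫ x in S, ‖scaledCoeff α r x‖ ≤ 1 + ∫ x in S, ‖g x‖ := by
    have h3 : ∫ x in S, ‖scaledCoeff α r x - g x‖ ≤ 1 := by
      rw [integral_norm_eq_lintegral_enorm hdiff.aestronglyMeasurable]
      exact ENNReal.toReal_le_of_le_ofReal zero_le_one (by rw [ENNReal.ofReal_one]; exact h1.le)
    calc ∫ x in S, ‖scaledCoeff α r x‖
        ≤ ∫ x in S, (‖scaledCoeff α r x - g x‖ + ‖g x‖) := by
          refine integral_mono hsc.norm (hdiff.norm.add hgS.norm) fun x => ?_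
          simpa using norm_add_le (scaledCoeff α r x - g x) (g x)
      _ ≤ 1 + ∫ x in S, ‖g x‖ := by
          rw [integral_add hdiff.norm hgS.norm]
          exact add_le_add_left h3 _
  set F : Lattice d → ℝ := {m : Lattice d | r ≤ ‖toSpace m‖}.indicator fun m => |α m| with hF
  have hFs : Summable F := hα.abs.indicator _
  have hint := integral_floorVec_smul hr0 hFs
  have hle : ∫ x : Space d, F (floorVec (r • x)) ≤ radialMax α r * ∫ x in S, ‖scaledCoeff α r x‖ := by
    rw [← integral_const_mul, ← integral_indicator (measurableSet_le_norm _)]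
    refine integral_mono (integrable_floorVec_smul hr0 hFs)
      ((integrable_indicator_iff (measurableSet_le_norm _)).2 (hsc.norm.const_mul _)) fun x => ?_
    by_cases hx : floorVec (r • x) ∈ {m : Lattice d | r ≤ ‖toSpace m‖}
    · have hxS : x ∈ S := by
        have h4 := norm_toSpace_floorVec_sub_le (r • x)
        have h5 : ‖toSpace (floorVec (r • x))‖ ≤ ‖toSpace (floorVec (r • x)) - r • x‖ + ‖r • x‖ := by
          simpa using norm_add_le (toSpace (floorVec (r • x)) - r • x) (r • x)
        rw [norm_smul, Real.norm_eq_abs, abs_of_pos hr0] at h5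
        have h6 : r ≤ ‖toSpace (floorVec (r • x))‖ := hx
        have h7 : r * (1 / 2) ≤ r * ‖x‖ := by linarith
        exact le_of_mul_le_mul_left h7 hr0
      rw [Set.indicator_of_mem hxS, hF, Set.indicator_of_mem hx]
      simp only [scaledCoeff]
      rw [Real.norm_eq_abs, abs_div, abs_of_pos hγ, mul_div_cancel₀ _ hγ.ne']
    · simp only [hF, Set.indicator_of_notMem hx]
      exact Set.indicator_nonneg (fun _ _ => by positivity) x
  have hrd : 0 < r ^ d := pow_pos hr0 d
  calc ∑' m, F m = r ^ d * ∫ x : Space d, F (floorVec (r • x)) := by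
        rw [hint, mul_inv_cancel_left₀ hrd.ne']
    _ ≤ r ^ d * (radialMax α r * (1 + ∫ x in S, ‖g x‖)) := by
        gcongr
        exact hle.trans (by gcongr)
    _ = (1 + ∫ x in S, ‖g x‖) * (r ^ d * radialMax α r) := by ring

/-! ### Pointwise limits of the scaled sums -/

/-- Replacing `g_t` by `g` costs at most the `L¹` error on `{‖x‖ ≥ δ}`, whatever the sets; then the
moving sets are handled by dominated convergence with majorant `|g|`. -/
theorem SpatialLimit.tendsto_setIntegral (hg : SpatialLimit α β g) (hα : Summable α)
    (hβ : (d : ℝ) < β) {δ : ℝ} (hδ : 0 < δ) {E : Set (Space d)} (hE : MeasurableSet E)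
    {E' : ℝ → Set (Space d)} (hE' : ∀ t, MeasurableSet (E' t))
    (hsub : ∀ᶠ t in atTop, E' t ⊆ {x | δ ≤ ‖x‖}) (hEsub : E ⊆ {x | δ ≤ ‖x‖})
    (hlim : ∀ᵐ x, ∀ᶠ t in atTop, x ∈ E' t ↔ x ∈ E) :
    Tendsto (fun t => ∫ x in E' t, scaledCoeff α t x) atTop (𝓝 (∫ x in E, g x)) := by
  set S : Set (Space d) := {x : Space d | δ ≤ ‖x‖} with hS
  have hSm : MeasurableSet S := measurableSet_le_norm δ
  have hgS : IntegrableOn g S := hg.integrableOn hα hβ hδ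
  have h1 : Tendsto (fun t => ∫ x in S, (E' t).indicator g x) atTop
      (𝓝 (∫ x in S, E.indicator g x)) := by
    refine tendsto_integral_filter_of_dominated_convergence (fun x => ‖g x‖) ?_ ?_ hgS.norm ?_
    · exact Eventually.of_forall fun t => hgS.aestronglyMeasurable.indicator (hE' t)
    · exact Eventually.of_forall fun t => Eventually.of_forall fun x => norm_indicator_le_norm_self _ _
    · filter_upwards [ae_restrict_of_ae hlim] with x hx
      refine tendsto_const_nhds.congr' ?_
      filter_upwards [hx] with t ht
      by_cases hxE : x ∈ E
      · rw [Set.indicator_of_mem hxE, Set.indicator_of_mem (ht.2 hxE)]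
      · rw [Set.indicator_of_notMem hxE, Set.indicator_of_notMem (mt ht.1 hxE)]
  have h2 : Tendsto (fun t => ∫ x in E' t, (scaledCoeff α t x - g x)) atTop (𝓝 0) := by
    have h3 := (ENNReal.tendsto_toReal ENNReal.zero_ne_top).comp (hg.tendsto_enorm hβ hδ)
    rw [ENNReal.toReal_zero] at h3
    refine squeeze_zero_norm' ?_ h3
    filter_upwards [hsub, eventually_gt_atTop 0] with t ht ht0
    have hi : IntegrableOn (fun x => scaledCoeff α t x - g x) S :=
      (integrable_scaledCoeff hα ht0).integrableOn.sub hgS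
    refine (norm_integral_le_integral_norm _).trans ?_
    simp only [Function.comp]
    rw [← integral_norm_eq_lintegral_enorm hi.aestronglyMeasurable]
    exact setIntegral_mono_set hi.norm (Eventually.of_forall fun x => norm_nonneg _)
      (LE.le.eventuallyLE ht)
  have h4 := h2.add h1
  rw [zero_add, setIntegral_indicator hE, Set.inter_eq_self_of_subset_right hEsub] at h4
  refine h4.congr' ?_
  filter_upwards [hsub, eventually_gt_atTop 0] with t ht ht0
  rw [setIntegral_indicator (hE' t), Set.inter_eq_self_of_subset_right ht,
    integral_sub (integrable_scaledCoeff hα ht0).integrableOn (hgS.mono_set ht)]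
  ring

/-- The set of `z` whose cell at scale `c` belongs to the shifted sites. -/
def shiftedCells (U : Set (Space d)) (c : ℝ) (j : Lattice d) : Set (Space d) :=
  (fun z => floorVec (c • z)) ⁻¹' shiftedSites U c j

theorem measurableSet_shiftedCells (U : Set (Space d)) (c : ℝ) (j : Lattice d) :
    MeasurableSet (shiftedCells U c j) :=
  measurable_floorVec_smul c (Set.to_countable _).measurableSet

theorem shiftSum_div_eq_integral (hα : Summable α) (U : Set (Space d)) {c : ℝ} (hc : 0 < c)
    (j : Lattice d) :
    shiftSum α U c j / (c ^ d * radialMax α c) = ∫ z in shiftedCells U c j, scaledCoeff α c z := by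
  have h := integral_floorVec_smul hc (hα.indicator (shiftedSites U c j))
  rw [← integral_indicator (measurableSet_shiftedCells U c j)]
  have e : ∀ z, (shiftedCells U c j).indicator (scaledCoeff α c) z
      = (shiftedSites U c j).indicator α (floorVec (c • z)) / radialMax α c := by
    intro z
    by_cases hz : floorVec (c • z) ∈ shiftedSites U c j
    · rw [Set.indicator_of_mem hz, Set.indicator_of_mem (show z ∈ shiftedCells U c j from hz)]
      rfl
    · rw [Set.indicator_of_notMem hz,
        Set.indicator_of_notMem (show z ∉ shiftedCells U c j from hz), zero_div]
  simp_rw [e]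
  rw [integral_div, h, shiftSum]
  rw [div_mul_eq_div_div, div_eq_inv_mul (∑' _, _) (c ^ d)]

theorem norm_inv_smul_toSpace_add_floorVec_sub_le {c : ℝ} (hc : 0 < c) (m : Lattice d)
    (x : Space d) :
    ‖c⁻¹ • toSpace (m + floorVec (c • x)) - (c⁻¹ • toSpace m + x)‖ ≤ Real.sqrt d / c := by
  have e : c⁻¹ • toSpace (m + floorVec (c • x)) - (c⁻¹ • toSpace m + x)
      = c⁻¹ • (toSpace (floorVec (c • x)) - c • x) := by
    rw [toSpace_add, smul_add, smul_sub, inv_smul_smul₀ hc.ne']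
    abel
  rw [e, norm_smul, Real.norm_eq_abs, abs_of_pos (inv_pos.2 hc), div_eq_inv_mul]
  exact mul_le_mul_of_nonneg_left (norm_toSpace_floorVec_sub_le _) (inv_pos.2 hc).le

theorem norm_inv_smul_toSpace_floorVec_add_sub_le {c : ℝ} (hc : 0 < c) (z x : Space d) :
    ‖c⁻¹ • toSpace (floorVec (c • z) + floorVec (c • x)) - (z + x)‖ ≤ 2 * Real.sqrt d / c := by
  have e : c⁻¹ • toSpace (floorVec (c • z) + floorVec (c • x)) - (z + x)
      = c⁻¹ • (toSpace (floorVec (c • z)) - c • z)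
        + c⁻¹ • (toSpace (floorVec (c • x)) - c • x) := by
    rw [toSpace_add, smul_add, smul_sub, smul_sub, inv_smul_smul₀ hc.ne', inv_smul_smul₀ hc.ne']
    abel
  rw [e]
  refine (norm_add_le _ _).trans ?_
  rw [norm_smul, norm_smul, Real.norm_eq_abs, abs_of_pos (inv_pos.2 hc), ← mul_add, div_eq_inv_mul]
  refine mul_le_mul_of_nonneg_left ?_ (inv_pos.2 hc).le
  linarith [norm_toSpace_floorVec_sub_le (c • z), norm_toSpace_floorVec_sub_le (c • x)]

theorem tendsto_inv_smul_toSpace_floorVec_add (z x : Space d) :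
    Tendsto (fun c : ℝ => c⁻¹ • toSpace (floorVec (c • z) + floorVec (c • x))) atTop
      (𝓝 (z + x)) := by
  rw [tendsto_iff_norm_sub_tendsto_zero]
  refine squeeze_zero' (Eventually.of_forall fun _ => norm_nonneg _) ?_
    (tendsto_const_nhds.div_atTop tendsto_id : Tendsto (fun c : ℝ => 2 * Real.sqrt d / c) atTop (𝓝 0))
  filter_upwards [eventually_gt_atTop 0] with c hc
  exact norm_inv_smul_toSpace_floorVec_add_sub_le hc z x

theorem exists_norm_ball_bound {U : Set (Space d)} {x : Space d} (hx : x ∉ closure U) :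
    ∃ ρ : ℝ, 0 < ρ ∧ ∀ y ∈ U, ρ ≤ ‖y - x‖ := by
  obtain ⟨ρ, hρ, h⟩ := Metric.isOpen_iff.1 isClosed_closure.isOpen_compl x hx
  refine ⟨ρ, hρ, fun y hy => ?_⟩
  by_contra hlt
  refine h (Metric.mem_ball.2 ?_) (subset_closure hy)
  rw [dist_eq_norm]
  exact not_le.1 hlt

theorem SpatialLimit.integrableOn_translate (hg : SpatialLimit α β g) (hα : Summable α)
    (hβ : (d : ℝ) < β) {U : Set (Space d)} (hU : MeasurableSet U) {x : Space d}
    (hx : x ∉ closure U) : IntegrableOn (fun y => g (y - x)) U := by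
  obtain ⟨ρ, hρ, h⟩ := exists_norm_ball_bound hx
  have h1 := (hg.integrableOn hα hβ hρ).integrable_indicator (measurableSet_le_norm ρ)
  have h2 := (h1.comp_sub_right x).integrableOn (s := U)
  refine h2.congr_fun (fun y hy => ?_) hU
  exact Set.indicator_of_mem (s := {x : Space d | ρ ≤ ‖x‖}) (h y hy) g

theorem setIntegral_translate {U : Set (Space d)} (hU : MeasurableSet U) (x : Space d) :
    ∫ z in {z | z + x ∈ U}, g z = ∫ y in U, g (y - x) := by
  have hm : MeasurableSet {z | z + x ∈ U} := (measurable_add_const x) hU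
  rw [← integral_indicator hm, ← integral_indicator hU,
    ← integral_sub_right_eq_self ({z | z + x ∈ U}.indicator g) x]
  congr 1
  funext y
  by_cases hy : y ∈ U
  · rw [Set.indicator_of_mem hy,
      Set.indicator_of_mem (show y - x ∈ {z | z + x ∈ U} by simpa using hy)]
  · rw [Set.indicator_of_notMem hy,
      Set.indicator_of_notMem (show y - x ∉ {z | z + x ∈ U} by simpa using hy)]

/-- Away from the closure of `U` the scaled sums over `U` converge to the integral of `g`. -/
theorem SpatialLimit.tendsto_shiftSum (hg : SpatialLimit α β g) (hα : Summable α)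
    (hβ : (d : ℝ) < β) {U : Set (Space d)} (hU : MeasurableSet U)
    (hfr : volume (frontier U) = 0) {x : Space d} (hx : x ∉ closure U) :
    Tendsto (fun c : ℝ => shiftSum α U c (floorVec (c • x)) / (c ^ d * radialMax α c)) atTop
      (𝓝 (∫ y in U, g (y - x))) := by
  obtain ⟨ρ, hρ, h⟩ := exists_norm_ball_bound hx
  rw [← setIntegral_translate hU x]
  have hsmall : Tendsto (fun c : ℝ => 2 * Real.sqrt d / c) atTop (𝓝 0) :=
    tendsto_const_nhds.div_atTop tendsto_id
  refine (hg.tendsto_setIntegral hα hβ (half_pos hρ) (E := {z | z + x ∈ U})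
    (E' := fun c => shiftedCells U c (floorVec (c • x))) ((measurable_add_const x) hU)
    (fun c => measurableSet_shiftedCells _ _ _) ?_ ?_ ?_).congr' ?_
  · filter_upwards [eventually_gt_atTop 0, hsmall.eventually_le_const (half_pos hρ)] with c hc hc2
    intro z hz
    have h1 := h _ hz
    have h2 := norm_inv_smul_toSpace_floorVec_add_sub_le hc z x
    have h3 : ‖c⁻¹ • toSpace (floorVec (c • z) + floorVec (c • x)) - x‖
        ≤ ‖c⁻¹ • toSpace (floorVec (c • z) + floorVec (c • x)) - (z + x)‖ + ‖z‖ := by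
      refine le_trans (le_of_eq ?_) (norm_add_le _ _)
      congr 1
      abel
    show ρ / 2 ≤ ‖z‖
    linarith
  · intro z hz
    have h1 := h _ hz
    rw [add_sub_cancel_right] at h1
    show ρ / 2 ≤ ‖z‖
    linarith
  -- Off the null frontier, membership in `U` is locally constant, hence insensitive to the
  -- vanishing rounding error.
  · have hnull : ∀ᵐ z : Space d, z + x ∉ frontier U := by
      rw [ae_iff]
      simp only [not_not]
      have : {z : Space d | z + x ∈ frontier U} = (fun z => z + x) ⁻¹' frontier U := rfl
      rw [this, measure_preimage_add_right, hfr]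
    filter_upwards [hnull] with z hz
    have ht := tendsto_inv_smul_toSpace_floorVec_add z x
    by_cases hzU : z + x ∈ U
    · have hint : z + x ∈ interior U := by
        by_contra hcon
        exact hz ⟨subset_closure hzU, hcon⟩
      filter_upwards [ht.eventually_mem (isOpen_interior.mem_nhds hint)] with c hc
      exact iff_of_true (show c⁻¹ • toSpace (_ + _) ∈ U from interior_subset hc) hzU
    · have hcl : z + x ∈ (closure U)ᶜ := fun hcon =>
        hz ⟨hcon, fun hi => hzU (interior_subset hi)⟩
      filter_upwards [ht.eventually_mem (isClosed_closure.isOpen_compl.mem_nhds hcl)] with c hc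
      exact iff_of_false (fun hcon => hc (subset_closure hcon)) hzU
  · filter_upwards [eventually_gt_atTop 0] with c hc
    exact (shiftSum_div_eq_integral hα U hc _).symm

end Coefficients

/-! ### Bounds for the scaled sums -/

section Bounds

variable {d : ℕ} {α : Lattice d → ℝ} {β : ℝ} {L : ℝ → ℝ} {g : Space d → ℝ}

/-- Potter's bounds for the radial maximum of the coefficients. -/
theorem RegularDecay.potter (hdecay : RegularDecay α β L) {δ : ℝ} (hδ : 0 < δ) :
    ∃ C T : ℝ, 1 ≤ C ∧ 1 ≤ T ∧ ∀ s, T ≤ s → 0 < radialMax α s ∧ ∀ t, s ≤ t →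
      radialMax α t ≤ C * (t / s) ^ (-(β - δ)) * radialMax α s ∧
      radialMax α s ≤ C * (s / t) ^ (-(β + δ)) * radialMax α t := by
  obtain ⟨C, T, hC, hT1, h⟩ := hdecay.slowly.potter hδ
  refine ⟨C, T, hC, hT1, fun s hs => ?_⟩
  have hs0 : 0 < s := by linarith
  refine ⟨?_, fun t hst => ?_⟩
  · rw [hdecay.eq s hs0]
    exact mul_pos (Real.rpow_pos_of_pos hs0 _) (h s hs).1
  · have ht0 : 0 < t := by linarith
    obtain ⟨h1, h2⟩ := (h s hs).2 t hst
    rw [hdecay.eq s hs0, hdecay.eq t ht0]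
    have hsβ : 0 < s ^ (-β) := Real.rpow_pos_of_pos hs0 _
    have htβ : 0 < t ^ (-β) := Real.rpow_pos_of_pos ht0 _
    have q0 : 0 < t / s := by positivity
    have e1 : (t / s) ^ (-(β - δ)) * s ^ (-β) = t ^ (-β) * (t / s) ^ δ := by
      rw [show -(β - δ) = -β + δ by ring, Real.rpow_add q0, Real.div_rpow ht0.le hs0.le (-β)]
      field_simp
    have e2 : (s / t) ^ (-(β + δ)) * t ^ (-β) = s ^ (-β) * (t / s) ^ δ := by
      rw [show -(β + δ) = -β + -δ by ring, Real.rpow_add (by positivity),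
        Real.div_rpow hs0.le ht0.le (-β), Real.rpow_neg (by positivity) δ,
        ← Real.inv_rpow (by positivity), inv_div]
      field_simp
    constructor
    · calc t ^ (-β) * L t ≤ t ^ (-β) * (C * (t / s) ^ δ * L s) := by gcongr
        _ = C * ((t / s) ^ (-(β - δ)) * s ^ (-β)) * L s := by rw [e1]; ring
        _ = _ := by ring
    · calc s ^ (-β) * L s ≤ s ^ (-β) * (C * (t / s) ^ δ * L t) := by gcongr
        _ = C * ((s / t) ^ (-(β + δ)) * t ^ (-β)) * L t := by rw [e2]; ring
        _ = _ := by ring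

/-- Compares the coefficient mass `s ^ d γ(s)` outside radius `s` with the normalization at the
larger scale `t`. -/
theorem RegularDecay.pow_mul_radialMax_le (hdecay : RegularDecay α β L) {δ : ℝ} (hδ : 0 < δ) :
    ∃ C T : ℝ, 1 ≤ C ∧ 1 ≤ T ∧ ∀ s, T ≤ s → 0 < radialMax α s ∧ ∀ t, s ≤ t →
      s ^ d * radialMax α s ≤ C * (s / t) ^ (-(β - d + δ)) * (t ^ d * radialMax α t) := by
  obtain ⟨C, T, hC, hT1, h⟩ := hdecay.potter hδ
  refine ⟨C, T, hC, hT1, fun s hs => ⟨(h s hs).1, fun t hst => ?_⟩⟩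
  have hs0 : 0 < s := by linarith
  have ht0 : 0 < t := by linarith
  have h2 := ((h s hs).2 t hst).2
  have e : (s / t) ^ (-(β - d + δ)) * t ^ d = s ^ d * (s / t) ^ (-(β + δ)) := by
    rw [show -(β - d + δ) = -(β + δ) + d by ring, Real.rpow_add (by positivity),
      Real.rpow_natCast, div_pow]
    field_simp
  calc s ^ d * radialMax α s ≤ s ^ d * (C * (s / t) ^ (-(β + δ)) * radialMax α t) := by gcongr
    _ = C * ((s / t) ^ (-(β - d + δ)) * t ^ d) * radialMax α t := by rw [e]; ring
    _ = _ := by ring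

theorem abs_shiftSum_le (hα : Summable α) (U : Set (Space d)) (c : ℝ) (j : Lattice d)
    {S : Set (Lattice d)} (hS : shiftedSites U c j ⊆ S) :
    |shiftSum α U c j| ≤ ∑' m, S.indicator (fun m => |α m|) m := by
  have h1 := norm_tsum_le_tsum_norm (hα.indicator (shiftedSites U c j)).norm
  rw [Real.norm_eq_abs] at h1
  refine h1.trans ((hα.indicator _).norm.tsum_le_tsum (fun m => ?_) (hα.abs.indicator S))
  by_cases hm : m ∈ shiftedSites U c j
  · rw [Set.indicator_of_mem hm, Set.indicator_of_mem (hS hm), Real.norm_eq_abs]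
  · rw [Set.indicator_of_notMem hm, norm_zero]
    exact Set.indicator_nonneg (fun _ _ => abs_nonneg _) m

theorem abs_shiftSum_le_tsum (hα : Summable α) (U : Set (Space d)) (c : ℝ) (j : Lattice d) :
    |shiftSum α U c j| ≤ ∑' m, |α m| := by
  simpa using abs_shiftSum_le hα U c j (Set.subset_univ _)

/-- The scaled sum over `U` at a point at distance `ρ` from `U` is at most of order
`ρ ^ (-(β - d + δ))`, uniformly in the scale. -/
theorem SpatialLimit.exists_near_bound (hg : SpatialLimit α β g) (hα : Summable α)
    (hdecay : RegularDecay α β L) (hβ : (d : ℝ) < β) {δ : ℝ} (hδ : 0 < δ) :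
    ∃ C Λ : ℝ, 0 ≤ C ∧ ∀ c, Λ ≤ c → ∀ (U : Set (Space d)) (x : Space d) (ρ : ℝ), 0 < ρ → ρ ≤ 1 →
      (∀ y ∈ U, ρ ≤ ‖y - x‖) →
      |shiftSum α U c (floorVec (c • x)) / (c ^ d * radialMax α c)|
        ≤ C * ρ ^ (-(β - d + δ)) := by
  obtain ⟨C₁, T₁, hC₁, hT₁, h₁⟩ := hdecay.pow_mul_radialMax_le hδ
  obtain ⟨C₂, T₂, hC₂, h₂⟩ := hg.exists_tail_bound hα hdecay hβ
  set T : ℝ := max (max T₁ T₂) (Real.sqrt d) with hT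
  have hTT₁ : T₁ ≤ T := (le_max_left _ _).trans (le_max_left _ _)
  have hTT₂ : T₂ ≤ T := (le_max_right _ _).trans (le_max_left _ _)
  have hTd : Real.sqrt d ≤ T := le_max_right _ _
  have hT0 : 0 < T := by linarith
  have hTγ : 0 < T ^ d * radialMax α T := mul_pos (pow_pos hT0 d) (h₁ T hTT₁).1
  have hA : 0 ≤ ∑' m, |α m| := tsum_nonneg fun _ => abs_nonneg _
  set M : ℝ := C₂ + (∑' m, |α m|) / (T ^ d * radialMax α T) with hM
  have hM0 : 0 ≤ M := by positivity
  have hκ : 0 ≤ β - d + δ := by linarith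
  refine ⟨M * C₁ * 2 ^ (β - d + δ), T, by positivity, fun c hc U x ρ hρ hρ1 hU => ?_⟩
  have hc0 : 0 < c := by linarith
  have hden : 0 < c ^ d * radialMax α c := mul_pos (pow_pos hc0 d) (h₁ c (hTT₁.trans hc)).1
  -- The contributing sites have norm at least `cρ - √d`, which is at least `cρ / 2` when `cρ / 2 ≥
  -- T`. Below `T` the tail and Potter bounds are unavailable; there the total mass `∑ |α|` is used,
  -- absorbed into `M`.
  set r : ℝ := max (c * ρ / 2) T with hr
  have hrT : T ≤ r := le_max_right _ _
  have hr0 : 0 < r := by linarith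
  have hrc : r ≤ c := max_le (by nlinarith) hc
  have hrγ : 0 < r ^ d * radialMax α r := mul_pos (pow_pos hr0 d) (h₁ r (hTT₁.trans hrT)).1
  have hsum : |shiftSum α U c (floorVec (c • x))| ≤ M * (r ^ d * radialMax α r) := by
    rcases le_total T (c * ρ / 2) with h | h
    · have hre : r = c * ρ / 2 := max_eq_left h
      have hsub : shiftedSites U c (floorVec (c • x)) ⊆ {m | r ≤ ‖toSpace m‖} := by
        intro m hm
        have h3 := hU _ hm
        have h4 := norm_inv_smul_toSpace_add_floorVec_sub_le hc0 m x
        have h5 : ‖c⁻¹ • toSpace (m + floorVec (c • x)) - x‖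
            ≤ ‖c⁻¹ • toSpace (m + floorVec (c • x)) - (c⁻¹ • toSpace m + x)‖
              + ‖c⁻¹ • toSpace m‖ := by
          refine le_trans (le_of_eq ?_) (norm_add_le _ _)
          congr 1
          abel
        rw [norm_smul, Real.norm_eq_abs, abs_of_pos (inv_pos.2 hc0), ← div_eq_inv_mul] at h5
        have h6 : ρ ≤ (Real.sqrt d + ‖toSpace m‖) / c := by rw [add_div]; linarith
        rw [le_div_iff₀ hc0] at h6
        show r ≤ ‖toSpace m‖
        rw [hre]
        nlinarith
      refine (abs_shiftSum_le hα U c _ hsub).trans ((h₂ r (hTT₂.trans hrT)).trans ?_)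
      refine mul_le_mul_of_nonneg_right ?_ hrγ.le
      exact le_add_of_nonneg_right (by positivity)
    · have hre : r = T := max_eq_right h
      refine (abs_shiftSum_le_tsum hα U c _).trans ?_
      rw [hre, hM, add_mul, div_mul_cancel₀ _ hTγ.ne']
      exact le_add_of_nonneg_left (by positivity)
  have hpot := (h₁ r (hTT₁.trans hrT)).2 c hrc
  have hρr : ρ / 2 ≤ r / c := by
    rw [le_div_iff₀ hc0]
    have := le_max_left (c * ρ / 2) T
    linarith
  have hpow : (r / c) ^ (-(β - d + δ)) ≤ 2 ^ (β - d + δ) * ρ ^ (-(β - d + δ)) := by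
    refine (Real.rpow_le_rpow_of_nonpos (by positivity) hρr (by linarith)).trans (le_of_eq ?_)
    rw [Real.div_rpow hρ.le (by norm_num), Real.rpow_neg (by norm_num : (0 : ℝ) ≤ 2), div_inv_eq_mul,
      mul_comm]
  rw [abs_div, abs_of_pos hden, div_le_iff₀ hden]
  calc |shiftSum α U c (floorVec (c • x))| ≤ M * (r ^ d * radialMax α r) := hsum
    _ ≤ M * (C₁ * (2 ^ (β - d + δ) * ρ ^ (-(β - d + δ))) * (c ^ d * radialMax α c)) := by
        refine mul_le_mul_of_nonneg_left (hpot.trans ?_) hM0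
        gcongr
    _ = _ := by ring

/-- The scaled sum over a bounded set decays like the coefficients at infinity. -/
theorem RegularDecay.exists_far_bound (hdecay : RegularDecay α β L) (hα : Summable α)
    {δ : ℝ} (hδ : 0 < δ) (hδβ : δ ≤ β) {R : ℝ} (hR : 0 ≤ R) :
    ∃ C Λ M : ℝ, 0 ≤ C ∧ 1 ≤ M ∧ ∀ c, Λ ≤ c → ∀ (U : Set (Space d)), (∀ y ∈ U, ‖y‖ ≤ R) →
      ∀ x : Space d, M ≤ ‖x‖ →
      |shiftSum α U c (floorVec (c • x)) / (c ^ d * radialMax α c)| ≤ C * ‖x‖ ^ (-(β - δ)) := by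
  obtain ⟨C₁, T, hC₁, hT1, h₁⟩ := hdecay.potter hδ
  have hd0 : 0 ≤ Real.sqrt d := Real.sqrt_nonneg _
  set v : ℝ := volume.real (Metric.closedBall (0 : Space d) (R + 2 * Real.sqrt d)) with hv
  have hv0 : 0 ≤ v := measureReal_nonneg
  -- This threshold on `‖x‖` forces `‖m‖ / c ≥ ‖x‖ / 2 ≥ 1` for every contributing site `m`, so
  -- Potter's bound applies from `c` up to `‖m‖`. The radius `R + 2√d` of the ball allows for two
  -- roundings.
  refine ⟨C₁ * 2 ^ (β - δ) * v, T, 2 * (R + Real.sqrt d) + 2, by positivity, by linarith,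
    fun c hc U hU x hx => ?_⟩
  have hc0 : 0 < c := by linarith
  have hdc : Real.sqrt d / c ≤ Real.sqrt d := div_le_self hd0 (by linarith)
  have hx0 : 0 < ‖x‖ := by linarith
  obtain ⟨hγ, hpot⟩ := h₁ c hc
  set j := floorVec (c • x) with hj
  have hcell : ∀ z ∈ shiftedCells U c j, z + x ∈ Metric.closedBall (0 : Space d) (R + 2 * Real.sqrt d) := by
    intro z hz
    have h2 := hU _ hz
    have h3 := norm_inv_smul_toSpace_floorVec_add_sub_le hc0 z x
    have h4 : ‖z + x‖ ≤ ‖c⁻¹ • toSpace (floorVec (c • z) + floorVec (c • x))‖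
        + ‖c⁻¹ • toSpace (floorVec (c • z) + floorVec (c • x)) - (z + x)‖ := by
      refine le_trans (le_of_eq ?_) (norm_sub_le _ _)
      congr 1
      abel
    rw [mul_div_assoc] at h3
    rw [mem_closedBall_zero_iff]
    linarith
  have hvol : volume (shiftedCells U c j)
      ≤ volume (Metric.closedBall (0 : Space d) (R + 2 * Real.sqrt d)) := by
    rw [← measure_preimage_add_right volume x (Metric.closedBall (0 : Space d) _)]
    exact measure_mono hcell
  have hfin : volume (Metric.closedBall (0 : Space d) (R + 2 * Real.sqrt d)) < ∞ :=
    measure_closedBall_lt_top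
  have hbound : ∀ z ∈ shiftedCells U c j,
      ‖scaledCoeff α c z‖ ≤ C₁ * (2 ^ (β - δ) * ‖x‖ ^ (-(β - δ))) := by
    intro z hz
    set m := floorVec (c • z) with hm
    have h2 : ‖c⁻¹ • toSpace (m + j)‖ ≤ R := hU _ hz
    have h4 := norm_inv_smul_toSpace_add_floorVec_sub_le hc0 m x
    have h5 : ‖x‖ ≤ ‖c⁻¹ • toSpace (m + j)‖
        + ‖c⁻¹ • toSpace (m + j) - (c⁻¹ • toSpace m + x)‖ + ‖c⁻¹ • toSpace m‖ := by
      have e : x = c⁻¹ • toSpace (m + j) - (c⁻¹ • toSpace (m + j) - (c⁻¹ • toSpace m + x))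
          - c⁻¹ • toSpace m := by abel
      calc ‖x‖ = ‖c⁻¹ • toSpace (m + j) - (c⁻¹ • toSpace (m + j) - (c⁻¹ • toSpace m + x))
          - c⁻¹ • toSpace m‖ := by rw [← e]
        _ ≤ _ := (norm_sub_le _ _).trans (add_le_add_left (norm_sub_le _ _) _)
    rw [norm_smul c⁻¹ (toSpace m), Real.norm_eq_abs, abs_of_pos (inv_pos.2 hc0),
      ← div_eq_inv_mul] at h5
    have h6 : ‖x‖ / 2 ≤ ‖toSpace m‖ / c := by linarith
    have h7 : 1 ≤ ‖toSpace m‖ / c := by linarith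
    have h8 : c ≤ ‖toSpace m‖ := (one_le_div hc0).1 h7
    have hm0 : toSpace m ≠ 0 := norm_ne_zero_iff.1 (by linarith)
    have h9 := (abs_le_radialMax hα hm0).trans (hpot _ h8).1
    simp only [scaledCoeff]
    rw [Real.norm_eq_abs, abs_div, abs_of_pos hγ, div_le_iff₀ hγ]
    refine h9.trans ?_
    gcongr
    refine (Real.rpow_le_rpow_of_nonpos (by positivity) h6 (by linarith)).trans (le_of_eq ?_)
    rw [Real.div_rpow hx0.le (by norm_num), Real.rpow_neg (by norm_num : (0 : ℝ) ≤ 2),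
      div_inv_eq_mul, mul_comm]
  rw [shiftSum_div_eq_integral hα U hc0, ← Real.norm_eq_abs]
  refine (norm_setIntegral_le_of_norm_le_const (hvol.trans_lt hfin) hbound).trans ?_
  have hvr : volume.real (shiftedCells U c j) ≤ v := ENNReal.toReal_mono hfin.ne hvol
  calc C₁ * (2 ^ (β - δ) * ‖x‖ ^ (-(β - δ))) * volume.real (shiftedCells U c j)
      ≤ C₁ * (2 ^ (β - δ) * ‖x‖ ^ (-(β - δ))) * v := by gcongr
    _ = _ := by ring

/-- The only place where the value `A = 0` enters: it trades a region containing the singularity for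
its complement. -/
theorem shiftSum_compl (hα : HasSum α 0) (U : Set (Space d)) (c : ℝ) (j : Lattice d) :
    shiftSum α Uᶜ c j = -shiftSum α U c j := by
  have h : shiftedSites Uᶜ c j = (shiftedSites U c j)ᶜ := rfl
  rw [shiftSum, shiftSum, h, eq_neg_iff_add_eq_zero,
    ← (hα.summable.indicator _).tsum_add (hα.summable.indicator _), ← hα.tsum_eq]
  exact tsum_congr fun m => Set.indicator_compl_add_self_apply _ _ _

end Bounds

/-! ### The sampling region -/

section Region

variable {d : ℕ} {R₀ : Set (Space d)}

/-- A ball that misses the frontier is connected, so it lies in the interior of `U` or off its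
closure and cannot contain both points. -/
theorem infDist_frontier_le_dist {U : Set (Space d)} {x y : Space d} (hxy : ¬(x ∈ U ↔ y ∈ U)) :
    Metric.infDist x (frontier U) ≤ dist y x := by
  by_contra! hlt
  set B := Metric.ball x (Metric.infDist x (frontier U)) with hB
  have hyB : y ∈ B := hlt
  have hxB : x ∈ B := Metric.mem_ball_self (dist_nonneg.trans_lt hlt)
  have hsub : B ⊆ interior U ∪ (closure U)ᶜ := by
    intro z hz
    by_contra hcon
    rw [Set.mem_union, not_or, Set.mem_compl_iff, not_not] at hcon
    have h1 := Metric.infDist_le_dist_of_mem (x := x) (show z ∈ frontier U from ⟨hcon.2, hcon.1⟩)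
    rw [hB, Metric.mem_ball, dist_comm] at hz
    linarith
  have hdisj : Disjoint (interior U) (closure U)ᶜ :=
    Set.disjoint_left.2 fun z h1 h2 => h2 (subset_closure (interior_subset h1))
  rcases (convex_ball x _).isPreconnected.subset_or_subset isOpen_interior
    isClosed_closure.isOpen_compl hdisj hsub with h | h
  · exact hxy (iff_of_true (interior_subset (h hxB)) (interior_subset (h hyB)))
  · exact hxy (iff_of_false (fun h' => h hxB (subset_closure h'))
      fun h' => h hyB (subset_closure h'))

theorem IsPrototype.norm_le (h : IsPrototype R₀) {x : Space d} (hx : x ∈ R₀) :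
    ‖x‖ ≤ Real.sqrt d := by
  rw [EuclideanSpace.norm_eq]
  refine Real.sqrt_le_sqrt ?_
  calc ∑ k, ‖x k‖ ^ 2 ≤ ∑ _k : Fin d, (1 : ℝ) := by
        refine Finset.sum_le_sum fun k _ => ?_
        have := h.subset_cube x hx k
        rw [Real.norm_eq_abs, sq_abs]
        nlinarith [this.1, this.2]
    _ = d := by simp

theorem IsPrototype.frontier_nonempty (h : IsPrototype R₀) (hd : 1 ≤ d) :
    (frontier R₀).Nonempty := by
  refine nonempty_frontier_iff.2 ⟨⟨0, h.zero_mem⟩, fun huniv => ?_⟩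
  have h1 := h.subset_cube (WithLp.toLp 2 fun _ => (1 : ℝ)) (huniv ▸ Set.mem_univ _) ⟨0, hd⟩
  norm_num at h1

theorem sub_infDist_subset_enlarge {A : Set (Space d)} (hA : IsClosed A) (hne : A.Nonempty)
    (e : ℝ) : {x | Metric.infDist x A ≤ e} ⊆ enlarge A e := by
  intro x hx
  obtain ⟨z, hz, h⟩ := hA.exists_infDist_eq_dist hne x
  refine ⟨z, hz, ?_⟩
  rw [← dist_eq_norm, dist_comm, ← h]
  exact hx

/-- Powers of exponent larger than `-1` of the distance to the boundary are integrable near the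
boundary. -/
theorem BoundaryRegular.exists_integrableOn_rpow (hb : BoundaryRegular R₀)
    (hne : (frontier R₀).Nonempty) {p : ℝ} (hp : -1 < p) :
    ∃ e : ℝ, 0 < e ∧ e ≤ 1 ∧ IntegrableOn (fun x => Metric.infDist x (frontier R₀) ^ p)
      {x | Metric.infDist x (frontier R₀) ≤ e} := by
  obtain ⟨C, hC1, hC⟩ := hb (fun t => t ^ p) (by fun_prop) fun t ht => Real.rpow_nonneg ht p
  have hC0 : 0 < C⁻¹ := by positivity
  have he1 : C⁻¹ ≤ 1 := inv_le_one_of_one_le₀ hC1.le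
  refine ⟨C⁻¹ / 2, by positivity, by linarith, ?_, ?_⟩
  · have : Measurable fun x : Space d => Metric.infDist x (frontier R₀) ^ p := by
      have := measurable_infDist (s := frontier R₀)
      fun_prop
    exact this.aestronglyMeasurable
  · have h1 := hC (C⁻¹ / 2) (by positivity) (by linarith)
    have h2 : IntegrableOn (fun t : ℝ => t ^ p) (Set.Ioc 0 (C⁻¹ / 2)) :=
      (intervalIntegrable_iff_integrableOn_Ioc_of_le (by positivity)).1
        (intervalIntegral.intervalIntegrable_rpow' hp)
    have h3 : ∫⁻ t in Set.Ioc 0 (C⁻¹ / 2), ENNReal.ofReal (t ^ p) < ∞ :=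
      (lintegral_mono fun t => Real.ofReal_le_enorm _).trans_lt h2.2
    have h4 : ∀ x : Space d, ‖Metric.infDist x (frontier R₀) ^ p‖ₑ
        = ENNReal.ofReal (Metric.infDist x (frontier R₀) ^ p) := fun x =>
      Real.enorm_of_nonneg (Real.rpow_nonneg Metric.infDist_nonneg p)
    show ∫⁻ x in _, ‖Metric.infDist x (frontier R₀) ^ p‖ₑ < ∞
    simp_rw [h4]
    exact (lintegral_mono_set (sub_infDist_subset_enlarge isClosed_frontier hne _)).trans_lt
      (h1.trans_lt (ENNReal.mul_lt_top ENNReal.ofReal_lt_top h3))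

end Region

/-! ### Convergence of the variances -/

section Variance

variable {d : ℕ} {α : Lattice d → ℝ} {β : ℝ} {L : ℝ → ℝ} {g : Space d → ℝ} {R₀ : Set (Space d)}

open Classical in
/-- Off the boundary the scaled sums converge to the limit function, up to a change of sign inside
the region. -/
theorem IsPrototype.tendsto_sign_mul (hR₀ : IsPrototype R₀) (hg : SpatialLimit α β g)
    (hA : HasSum α 0) (hβ : (d : ℝ) < β) {x : Space d} (hx : x ∉ frontier R₀) :
    Tendsto (fun c : ℝ => shiftSum α R₀ c (floorVec (c • x)) / (c ^ d * radialMax α c)) atTop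
      (𝓝 ((if x ∈ R₀ then -1 else 1) * limitG R₀ g x)) := by
  have hm : MeasurableSet R₀ := hR₀.isOpen.measurableSet
  by_cases hxR : x ∈ R₀
  · have hcl : x ∉ closure R₀ᶜ := by
      rw [hR₀.isOpen.isClosed_compl.closure_eq]
      exact fun h => h hxR
    have h := (hg.tendsto_shiftSum hA.summable hβ hm.compl
      (by rw [frontier_compl]; exact hR₀.frontier_null) hcl).neg
    have e : limitG R₀ g x = ∫ y in R₀ᶜ, g (y - x) := by
      rw [limitG, if_neg (fun h => h (Or.inl hxR)), if_pos hxR]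
    rw [if_pos hxR, e, neg_one_mul]
    refine h.congr fun c => ?_
    rw [shiftSum_compl hA, neg_div, neg_neg]
  · have hun : x ∈ (R₀ ∪ frontier R₀)ᶜ := fun h => h.elim hxR hx
    have e : limitG R₀ g x = ∫ y in R₀, g (y - x) := by rw [limitG, if_pos hun]
    rw [if_neg hxR, e, one_mul]
    refine hg.tendsto_shiftSum hA.summable hβ hm hR₀.frontier_null ?_
    rwa [closure_eq_self_union_frontier]

/-- The squares of the scaled sums over the sampling region are dominated by an integrable
function. -/
theorem IsPrototype.exists_dominating (hR₀ : IsPrototype R₀) (hd : 1 ≤ d)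
    (hb : BoundaryRegular R₀) (hg : SpatialLimit α β g) (hA : HasSum α 0)
    (hdecay : RegularDecay α β L) (hβ : (d : ℝ) < β) (hβ' : β < (d : ℝ) + 1 / 2) :
    ∃ (D : Space d → ℝ) (Λ : ℝ), Integrable D ∧ ∀ c, Λ ≤ c → ∀ x, x ∉ frontier R₀ →
      (shiftSum α R₀ c (floorVec (c • x)) / (c ^ d * radialMax α c)) ^ 2 ≤ D x := by
  have hd1 : (1 : ℝ) ≤ d := by exact_mod_cast hd
  -- Half of the available gap: then `2κ < 1`, for integrability at the boundary, and `2(β - δ) >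
  -- d`, for integrability at infinity.
  set δ : ℝ := (d + 1 / 2 - β) / 2 with hδ
  have hδ0 : 0 < δ := by linarith
  set κ : ℝ := β - d + δ with hκ
  have hκ0 : 0 < κ := by linarith
  have hne := hR₀.frontier_nonempty hd
  obtain ⟨C₁, Λ₁, hC₁, hnear⟩ := hg.exists_near_bound hA.summable hdecay hβ hδ0
  obtain ⟨C₂, Λ₂, M, hC₂, hM, hfar⟩ := hdecay.exists_far_bound hA.summable hδ0
    (by linarith : δ ≤ β) (Real.sqrt_nonneg (d : ℝ))
  obtain ⟨e, he0, he1, hint⟩ := hb.exists_integrableOn_rpow hne (p := -(2 * κ)) (by linarith)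
  set ρ : Space d → ℝ := fun x => Metric.infDist x (frontier R₀) with hρ
  have hSm : MeasurableSet {x | ρ x ≤ e} := measurableSet_le measurable_infDist measurable_const
  -- Three zones: a collar of the boundary, the rest of a large ball, and the neighbourhood of
  -- infinity.
  set D₁ : Space d → ℝ := {x | ρ x ≤ e}.indicator fun x => ρ x ^ (-(2 * κ)) with hD₁
  set D₂ : Space d → ℝ := (Metric.ball (0 : Space d) M).indicator fun _ => e ^ (-(2 * κ)) with hD₂
  set D₃ : Space d → ℝ := fun x => (1 + ‖x‖) ^ (-(2 * (β - δ))) with hD₃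
  have hi₁ : Integrable D₁ := (integrable_indicator_iff hSm).2 hint
  have hi₂ : Integrable D₂ := (integrable_indicator_iff measurableSet_ball).2
    (integrableOn_const measure_ball_lt_top.ne)
  have hi₃ : Integrable D₃ := integrable_one_add_norm (by
    rw [finrank_euclideanSpace, Fintype.card_fin]
    linarith)
  refine ⟨fun x => C₁ ^ 2 * (D₁ x + D₂ x) + C₂ ^ 2 * 2 ^ (2 * (β - δ)) * D₃ x, max Λ₁ Λ₂,
    ((hi₁.add hi₂).const_mul _).add (hi₃.const_mul _), fun c hc x hx => ?_⟩
  have hρx : 0 < ρ x := by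
    rcases (Metric.infDist_nonneg (x := x) (s := frontier R₀)).lt_or_eq with h | h
    · exact h
    · exact absurd ((isClosed_frontier.mem_iff_infDist_zero hne).2 h.symm) hx
  have hD₁0 : 0 ≤ D₁ x := Set.indicator_nonneg
    (fun y _ => Real.rpow_nonneg Metric.infDist_nonneg _) x
  have hD₂0 : 0 ≤ D₂ x := Set.indicator_nonneg (fun y _ => Real.rpow_nonneg he0.le _) x
  have hD₃0 : 0 ≤ D₃ x := Real.rpow_nonneg (by positivity) _
  have hsq : ∀ {a q p : ℝ} {C : ℝ}, 0 < q → |a| ≤ C * q ^ p → a ^ 2 ≤ C ^ 2 * q ^ (2 * p) := by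
    intro a q p C hq h
    rw [← sq_abs]
    refine (pow_le_pow_left₀ (abs_nonneg a) h 2).trans (le_of_eq ?_)
    rw [mul_pow, mul_comm 2 p, Real.rpow_mul hq.le, Real.rpow_two]
  rcases lt_or_ge ‖x‖ M with hxM | hxM
  -- `r` is at most one and bounds from below the distance from `x` to the side of the boundary not
  -- containing it; the near bound is applied to that side.
  · set r : ℝ := min (ρ x) e with hr
    have hr0 : 0 < r := lt_min hρx he0
    have hbd : |shiftSum α R₀ c (floorVec (c • x)) / (c ^ d * radialMax α c)| ≤ C₁ * r ^ (-κ) := by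
      have hdist : ∀ y, ¬(x ∈ R₀ ↔ y ∈ R₀) → r ≤ ‖y - x‖ := fun y hy => by
        rw [← dist_eq_norm]
        exact (min_le_left _ _).trans (infDist_frontier_le_dist hy)
      by_cases hxR : x ∈ R₀
      · have h := hnear c ((le_max_left _ _).trans hc) R₀ᶜ x r hr0 ((min_le_right _ _).trans he1)
          fun y hy => hdist y fun h => hy (h.1 hxR)
        rwa [shiftSum_compl hA, neg_div, abs_neg] at h
      · exact hnear c ((le_max_left _ _).trans hc) R₀ x r hr0 ((min_le_right _ _).trans he1)
          fun y hy => hdist y fun h => hxR (h.2 hy)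
    have h1 := hsq hr0 hbd
    have h2 : r ^ (2 * -κ) ≤ D₁ x + D₂ x := by
      rw [mul_neg]
      rcases le_total (ρ x) e with h | h
      · rw [hr, min_eq_left h]
        have : D₁ x = ρ x ^ (-(2 * κ)) :=
          Set.indicator_of_mem (show x ∈ {x | ρ x ≤ e} from h) fun x => ρ x ^ (-(2 * κ))
        linarith
      · rw [hr, min_eq_right h]
        have : D₂ x = e ^ (-(2 * κ)) := Set.indicator_of_mem (by simpa using hxM) _
        linarith
    have h3 : 0 ≤ C₂ ^ 2 * 2 ^ (2 * (β - δ)) * D₃ x := by positivity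
    have h4 := mul_le_mul_of_nonneg_left h2 (sq_nonneg C₁)
    simp only
    linarith
  · have hx0 : 0 < ‖x‖ := by linarith
    have h1 := hsq hx0 (hfar c ((le_max_right _ _).trans hc) R₀ (fun y hy => hR₀.norm_le hy) x hxM)
    have h2 : ‖x‖ ^ (2 * -(β - δ)) ≤ 2 ^ (2 * (β - δ)) * D₃ x := by
      have h5 : (1 + ‖x‖) / 2 ≤ ‖x‖ := by linarith
      have h6 := Real.rpow_le_rpow_of_nonpos (z := -(2 * (β - δ))) (by positivity) h5 (by linarith)
      rw [Real.div_rpow (by positivity) (by norm_num), Real.rpow_neg (by norm_num : (0 : ℝ) ≤ 2),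
        div_inv_eq_mul] at h6
      rw [mul_neg, mul_comm (2 ^ (2 * (β - δ)))]
      exact h6
    have h3 : 0 ≤ C₁ ^ 2 * (D₁ x + D₂ x) := by positivity
    have h4 := mul_le_mul_of_nonneg_left h2 (sq_nonneg C₂)
    simp only
    linarith

-- Dominated convergence for the squares. The majorant also bounds the square of the limit, which
-- gives its membership in `L²`.
open Classical in
theorem IsPrototype.memLp_limitG_and_tendsto (hR₀ : IsPrototype R₀) (hd : 1 ≤ d)
    (hb : BoundaryRegular R₀) (hg : SpatialLimit α β g) (hA : HasSum α 0)
    (hdecay : RegularDecay α β L) (hβ : (d : ℝ) < β) (hβ' : β < (d : ℝ) + 1 / 2) :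
    MemLp (limitG R₀ g) 2 volume ∧
    Tendsto (fun c : ℝ => ∫ x : Space d,
      (shiftSum α R₀ c (floorVec (c • x)) / (c ^ d * radialMax α c)) ^ 2) atTop
      (𝓝 (∫ x, limitG R₀ g x ^ 2)) := by
  obtain ⟨D, Λ, hD, hdom⟩ := hR₀.exists_dominating hd hb hg hA hdecay hβ hβ'
  have hfr : ∀ᵐ x : Space d, x ∉ frontier R₀ := by
    rw [ae_iff]
    simp only [not_not]
    exact hR₀.frontier_null
  have hmeas : ∀ c : ℝ, Measurable fun x : Space d =>
      shiftSum α R₀ c (floorVec (c • x)) / (c ^ d * radialMax α c) := fun c =>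
    ((measurable_of_countable (shiftSum α R₀ c)).comp (measurable_floorVec_smul c)).div_const _
  -- Measurability of the limit function comes from the convergence itself; the sign is measurable
  -- and squares to one, so it can be removed afterwards.
  have hJ : AEStronglyMeasurable
      (fun x : Space d => (if x ∈ R₀ then (-1 : ℝ) else 1) * limitG R₀ g x) volume :=
    aestronglyMeasurable_of_tendsto_ae atTop (fun c : ℝ => (hmeas c).aestronglyMeasurable)
      (hfr.mono fun x hx => hR₀.tendsto_sign_mul hg hA hβ hx)
  have hsign : Measurable fun x : Space d => if x ∈ R₀ then (-1 : ℝ) else 1 :=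
    Measurable.ite hR₀.isOpen.measurableSet measurable_const measurable_const
  have hG : AEStronglyMeasurable (limitG R₀ g) volume := by
    refine (hsign.aestronglyMeasurable.mul hJ).congr (Eventually.of_forall fun x => ?_)
    simp only [Pi.mul_apply]
    split_ifs <;> ring
  have hlim : ∀ᵐ x : Space d, Tendsto (fun c : ℝ =>
      (shiftSum α R₀ c (floorVec (c • x)) / (c ^ d * radialMax α c)) ^ 2) atTop
      (𝓝 (limitG R₀ g x ^ 2)) := by
    filter_upwards [hfr] with x hx
    have h := (hR₀.tendsto_sign_mul hg hA hβ hx).pow 2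
    have e : ((if x ∈ R₀ then (-1 : ℝ) else 1) * limitG R₀ g x) ^ 2 = limitG R₀ g x ^ 2 := by
      split_ifs <;> ring
    rwa [e] at h
  refine ⟨(memLp_two_iff_integrable_sq hG).2 ?_, ?_⟩
  · refine hD.mono' (hG.pow 2) ?_
    filter_upwards [hfr, hlim] with x hx hl
    rw [Real.norm_eq_abs, abs_of_nonneg (sq_nonneg _)]
    exact le_of_tendsto hl ((eventually_ge_atTop Λ).mono fun c hc => hdom c hc x hx)
  · refine tendsto_integral_filter_of_dominated_convergence D
      (Eventually.of_forall fun c => ((hmeas c).pow_const 2).aestronglyMeasurable) ?_ hD hlim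
    filter_upwards [eventually_ge_atTop Λ] with c hc
    filter_upwards [hfr] with x hx
    rw [Real.norm_eq_abs, abs_of_nonneg (sq_nonneg _)]
    exact hdom c hc x hx

end Variance

/-! ### The sums over the sampling region -/

section SiteSum

variable {d : ℕ} {α : Lattice d → ℝ} {β : ℝ} {L : ℝ → ℝ} {R₀ : Set (Space d)}

theorem mem_sites_iff {c : ℝ} (hc : 0 < c) (i : Lattice d) :
    i ∈ sites R₀ c ↔ c⁻¹ • toSpace i ∈ R₀ :=
  Set.mem_smul_set_iff_inv_smul_mem₀ hc.ne' _ _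

theorem sum_sites_eq_shiftSum (hR₀ : IsPrototype R₀) {c : ℝ} (hc : 0 < c) (j : Lattice d) :
    ∑ i ∈ (sites_finite hR₀ c).toFinset, α (i - j) = shiftSum α R₀ c j := by
  rw [shiftSum, ← (Equiv.subRight j).tsum_eq, tsum_eq_sum (s := (sites_finite hR₀ c).toFinset)]
  · refine Finset.sum_congr rfl fun i hi => (Set.indicator_of_mem ?_ α).symm
    have h := (mem_sites_iff hc i).1 ((Set.Finite.mem_toFinset _).1 hi)
    show c⁻¹ • toSpace (i - j + j) ∈ R₀
    rwa [sub_add_cancel]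
  · intro i hi
    refine Set.indicator_of_notMem (fun h => hi ?_) α
    rw [Set.Finite.mem_toFinset, mem_sites_iff hc]
    have h' : c⁻¹ • toSpace (i - j + j) ∈ R₀ := h
    rwa [sub_add_cancel] at h'

theorem summable_shiftSum_sq (hα : Summable α) (hR₀ : IsPrototype R₀) {c : ℝ} (hc : 0 < c) :
    Summable fun j => shiftSum α R₀ c j ^ 2 := by
  have h1 : Summable fun j => shiftSum α R₀ c j := by
    simp_rw [← sum_sites_eq_shiftSum hR₀ hc]
    refine summable_sum fun i _ => ?_
    exact (Equiv.subLeft i).summable_iff.2 hα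
  refine Summable.of_nonneg_of_le (fun j => sq_nonneg _) (fun j => ?_)
    (h1.abs.mul_left (∑' m, |α m|))
  rw [← sq_abs, sq]
  exact mul_le_mul_of_nonneg_right (abs_shiftSum_le_tsum hα _ _ _) (abs_nonneg _)

/-- Splits the normalization into the scale `c ^ d γ(c)` of one weight and the factor `c ^ (d / 2)`,
whose square is the number of cells per unit volume. -/
theorem sqrt_norm_eq (hdecay : RegularDecay α β L) {c : ℝ} (hc : 0 < c) :
    Real.sqrt (c ^ (3 * (d : ℝ) - 2 * β) * L c ^ 2) =
      c ^ ((d : ℝ) / 2) * (c ^ d * radialMax α c) := by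
  have hL := hdecay.slowly.nonneg c hc
  rw [hdecay.eq c hc]
  refine Real.sqrt_eq_iff_mul_self_eq (by positivity) (by positivity) |>.2 ?_
  have e : c ^ (3 * (d : ℝ) - 2 * β)
      = c ^ ((d : ℝ) / 2) * c ^ ((d : ℝ) / 2) * (c ^ d * c ^ d) * (c ^ (-β) * c ^ (-β)) := by
    simp only [← Real.rpow_natCast, ← Real.rpow_add hc]
    congr 1
    ring
  rw [e]
  ring

theorem tsum_weights_sq_eq (hα : Summable α) (hdecay : RegularDecay α β L)
    (hR₀ : IsPrototype R₀) {c : ℝ} (hc : 0 < c) :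
    ∑' j, (shiftSum α R₀ c j / Real.sqrt (c ^ (3 * (d : ℝ) - 2 * β) * L c ^ 2)) ^ 2 =
      ∫ x : Space d, (shiftSum α R₀ c (floorVec (c • x)) / (c ^ d * radialMax α c)) ^ 2 := by
  have hs : Summable fun j => (shiftSum α R₀ c j / (c ^ d * radialMax α c)) ^ 2 := by
    simp_rw [div_pow]
    exact (summable_shiftSum_sq hα hR₀ hc).div_const _
  rw [integral_floorVec_smul hc hs, ← tsum_mul_left, sqrt_norm_eq hdecay hc]
  refine tsum_congr fun j => ?_
  have e : (c ^ ((d : ℝ) / 2)) ^ 2 = c ^ d := by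
    rw [← Real.rpow_natCast, ← Real.rpow_mul hc.le, ← Real.rpow_natCast]
    congr 1
    push_cast
    ring
  rw [div_pow, div_pow, mul_pow, e, mul_comm (c ^ d), div_mul_eq_div_div, div_eq_inv_mul _ (c ^ d)]

theorem RegularDecay.tendsto_normalization (hdecay : RegularDecay α β L) (hd : 1 ≤ d)
    (hβ' : β < (d : ℝ) + 1 / 2) :
    Tendsto (fun c : ℝ => Real.sqrt (c ^ (3 * (d : ℝ) - 2 * β) * L c ^ 2)) atTop atTop := by
  have hd1 : (1 : ℝ) ≤ d := by exact_mod_cast hd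
  set δ : ℝ := (d + 1 / 2 - β) / 2 with hδ
  obtain ⟨C, T, hC, hT1, h⟩ := hdecay.pow_mul_radialMax_le (show 0 < δ by linarith)
  obtain ⟨hγ, hpot⟩ := h T le_rfl
  have hT0 : 0 < T := by linarith
  set κ : ℝ := β - d + δ with hκ
  set A : ℝ := T ^ d * radialMax α T with hA
  have hA0 : 0 < A := mul_pos (pow_pos hT0 d) hγ
  -- The exponent is positive because `κ < 1 / 2 ≤ d / 2`.
  have hlow : Tendsto (fun c : ℝ => A * T ^ κ / C * c ^ ((d : ℝ) / 2 - κ)) atTop atTop :=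
    (tendsto_rpow_atTop (by linarith)).const_mul_atTop (by positivity)
  refine tendsto_atTop_mono' _ ?_ hlow
  filter_upwards [eventually_ge_atTop T] with c hc
  have hc0 : 0 < c := by linarith
  rw [sqrt_norm_eq hdecay hc0]
  have h1 := hpot c hc
  have h2 : (T / c) ^ (-κ) = c ^ κ / T ^ κ := by
    rw [Real.rpow_neg (by positivity), Real.div_rpow hT0.le hc0.le, inv_div]
  rw [h2] at h1
  have hTκ : 0 < T ^ κ := Real.rpow_pos_of_pos hT0 _
  have hcκ : 0 < c ^ κ := Real.rpow_pos_of_pos hc0 _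
  have h3 : A * T ^ κ / C / c ^ κ ≤ c ^ d * radialMax α c := by
    rw [div_div, div_le_iff₀ (by positivity)]
    have := mul_le_mul_of_nonneg_right h1 hTκ.le
    refine this.trans (le_of_eq ?_)
    field_simp
  rw [Real.rpow_sub hc0]
  calc A * T ^ κ / C * (c ^ ((d : ℝ) / 2) / c ^ κ)
      = c ^ ((d : ℝ) / 2) * (A * T ^ κ / C / c ^ κ) := by ring
    _ ≤ _ := by gcongr

theorem siteSum_eq_sum {Ω : Type*} {Z : Lattice d → Ω → ℝ} (hR₀ : IsPrototype R₀) (c : ℝ) (ω : Ω) :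
    siteSum Z R₀ c ω = ∑ i ∈ (sites_finite hR₀ c).toFinset, Z i ω :=
  finsum_mem_eq_finite_toFinset_sum _ _

end SiteSum

/-! ### The site sum as an `L²` series in the errors, and its mean -/

section LinearField

variable {d : ℕ} {Ω : Type*} [MeasurableSpace Ω] {P : Measure Ω}
  {μ : ℝ} {α : Lattice d → ℝ} {ε Z : Lattice d → Ω → ℝ} {R₀ : Set (Space d)}

theorem IsLinearProcess.memLp_siteSum (hZ : IsLinearProcess Z μ α ε P) (hR₀ : IsPrototype R₀)
    (c : ℝ) : MemLp (siteSum Z R₀ c) 2 P := by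
  have : siteSum Z R₀ c = fun ω => ∑ i ∈ (sites_finite hR₀ c).toFinset, Z i ω :=
    funext fun ω => siteSum_eq_sum hR₀ c ω
  rw [this]
  exact memLp_finsetSum _ fun i _ => hZ.memLp i

theorem IsLinearProcess.tendsto_siteSum (hZ : IsLinearProcess Z μ α ε P) [IsProbabilityMeasure P]
    (hR₀ : IsPrototype R₀) {c : ℝ} (hc : 0 < c) :
    Tendsto (fun s : Finset (Lattice d) => eLpNorm (fun ω => siteSum Z R₀ c ω
      - (sites_finite hR₀ c).toFinset.card * μ - ∑ j ∈ s, shiftSum α R₀ c j * ε j ω) 2 P)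
      atTop (𝓝 0) := by
  set F := (sites_finite hR₀ c).toFinset with hF
  have h0 := tendsto_finsetSum F fun i _ => hZ.series i
  simp only [Finset.sum_const_zero] at h0
  refine tendsto_of_tendsto_of_tendsto_of_le_of_le tendsto_const_nhds h0 (fun _ => bot_le)
    fun s => ?_
  have e : (fun ω => siteSum Z R₀ c ω - F.card * μ - ∑ j ∈ s, shiftSum α R₀ c j * ε j ω)
      = ∑ i ∈ F, fun ω => Z i ω - (μ + ∑ j ∈ s, α (i - j) * ε j ω) := by
    funext ω
    rw [Finset.sum_apply, siteSum_eq_sum hR₀, ← hF, Finset.sum_sub_distrib, Finset.sum_add_distrib,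
      Finset.sum_const, nsmul_eq_mul, Finset.sum_comm, sub_sub]
    congr 2
    refine Finset.sum_congr rfl fun j _ => ?_
    rw [← sum_sites_eq_shiftSum hR₀ hc, Finset.sum_mul]
  rw [e]
  refine eLpNorm_sum_le (fun i _ => ?_) one_le_two
  exact (hZ.memLp i).aestronglyMeasurable.sub (aestronglyMeasurable_const.add
    (memLp_finsetSum s fun j _ => (hZ.errors.memLp j).const_mul _).aestronglyMeasurable)

/-- The mean is continuous in `L²`, and every finite weighted sum of errors has mean zero. -/
theorem IsLinearProcess.integral_siteSum (hZ : IsLinearProcess Z μ α ε P) [IsProbabilityMeasure P]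
    (hR₀ : IsPrototype R₀) {c : ℝ} (hc : 0 < c) :
    ∫ ω, siteSum Z R₀ c ω ∂P = (sites_finite hR₀ c).toFinset.card * μ := by
  set F := (sites_finite hR₀ c).toFinset with hF
  have hS := hZ.memLp_siteSum hR₀ c
  have hW : ∀ s : Finset (Lattice d), MemLp (fun ω => ∑ j ∈ s, shiftSum α R₀ c j * ε j ω) 2 P :=
    fun s => memLp_finsetSum s fun j _ => (hZ.errors.memLp j).const_mul _
  have hle : ∀ s : Finset (Lattice d), |∫ ω, siteSum Z R₀ c ω ∂P - F.card * μ|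
      ≤ (eLpNorm (fun ω => siteSum Z R₀ c ω - F.card * μ
        - ∑ j ∈ s, shiftSum α R₀ c j * ε j ω) 2 P).toReal := by
    intro s
    have hd : MemLp (fun ω => siteSum Z R₀ c ω - F.card * μ
        - ∑ j ∈ s, shiftSum α R₀ c j * ε j ω) 2 P := (hS.sub (memLp_const _)).sub (hW s)
    have hi := hS.integrable one_le_two
    have hic : Integrable (fun ω => siteSum Z R₀ c ω - F.card * μ) P :=
      hi.sub (integrable_const _)
    have hW0 : ∫ ω, ∑ j ∈ s, shiftSum α R₀ c j * ε j ω ∂P = 0 := by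
      rw [integral_finsetSum _ fun j _ => ((hZ.errors.memLp j).integrable one_le_two).const_mul _]
      refine Finset.sum_eq_zero fun j _ => ?_
      rw [integral_const_mul, hZ.errors.mean_zero j, mul_zero]
    have e : ∫ ω, siteSum Z R₀ c ω ∂P - F.card * μ = ∫ ω, (siteSum Z R₀ c ω - F.card * μ
        - ∑ j ∈ s, shiftSum α R₀ c j * ε j ω) ∂P := by
      rw [integral_sub hic ((hW s).integrable one_le_two), integral_sub hi (integrable_const _), hW0]
      simp
    rw [e, ← Real.norm_eq_abs]
    refine (norm_integral_le_integral_norm _).trans ?_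
    rw [integral_norm_eq_lintegral_enorm hd.aestronglyMeasurable, ← eLpNorm_one_eq_lintegral_enorm]
    exact ENNReal.toReal_mono hd.eLpNorm_ne_top
      (eLpNorm_le_eLpNorm_of_exponent_le one_le_two hd.aestronglyMeasurable)
  have hlim := (ENNReal.tendsto_toReal ENNReal.zero_ne_top).comp (hZ.tendsto_siteSum hR₀ hc)
  have h := ge_of_tendsto' hlim hle
  rw [ENNReal.toReal_zero] at h
  exact sub_eq_zero.1 (abs_nonpos_iff.1 h)

end LinearField

end SpatialCLT

end

theorem theorem4p1 {d : ℕ} (hd : 1 ≤ d)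
    {Ω : Type*} [MeasurableSpace Ω] (P : Measure Ω) [IsProbabilityMeasure P]
    (μ : ℝ) (α : SpatialCLT.Lattice d → ℝ) (ε Z : SpatialCLT.Lattice d → Ω → ℝ)
    (hZ : SpatialCLT.IsLinearProcess Z μ α ε P)
    (R₀ : Set (SpatialCLT.Space d)) (hR₀ : SpatialCLT.IsPrototype R₀)
    (lam : ℕ → ℝ) (hlam_pos : ∀ n, 0 < lam n) (hlam : Tendsto lam atTop atTop)
    (β : ℝ) (hβ_lower : (d : ℝ) < β) (hβ_upper : β < (d : ℝ) + 1 / 2)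
    (L : ℝ → ℝ) (g : SpatialCLT.Space d → ℝ)
    (hdecay : SpatialCLT.RegularDecay α β L)
    (hlimit : SpatialCLT.SpatialLimit α β g)
    (hboundary : SpatialCLT.BoundaryRegular R₀)
    (hA : HasSum α 0) :
    (∀ x ∈ (R₀ ∪ frontier R₀)ᶜ, IntegrableOn (fun y => g (y - x)) R₀) ∧
    (∀ x ∈ R₀, IntegrableOn (fun y => g (y - x)) R₀ᶜ) ∧
    MemLp (SpatialCLT.limitG R₀ g) 2 volume ∧
    TendstoInDistribution
      (fun (n : ℕ) (ω : Ω) =>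
        (SpatialCLT.siteSum Z R₀ (lam n) ω - ∫ ω', SpatialCLT.siteSum Z R₀ (lam n) ω' ∂P) /
          Real.sqrt (lam n ^ (3 * (d : ℝ) - 2 * β) * L (lam n) ^ 2))
      atTop (id : ℝ → ℝ) (fun _ => P)
      (gaussianReal 0 (∫ x, SpatialCLT.limitG R₀ g x ^ 2).toNNReal) := by
  have hm : MeasurableSet R₀ := hR₀.isOpen.measurableSet
  obtain ⟨hG, hvar⟩ := hR₀.memLp_limitG_and_tendsto hd hboundary hlimit hA hdecay hβ_lower hβ_upper
  refine ⟨fun x hx => ?_, fun x hx => ?_, hG, ?_⟩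
  · refine hlimit.integrableOn_translate hA.summable hβ_lower hm ?_
    rwa [closure_eq_self_union_frontier]
  · refine hlimit.integrableOn_translate hA.summable hβ_lower hm.compl ?_
    rw [hR₀.isOpen.isClosed_compl.closure_eq]
    exact fun h => h hx
  · set N : ℕ → ℝ := fun n => Real.sqrt (lam n ^ (3 * (d : ℝ) - 2 * β) * L (lam n) ^ 2) with hN
    have hNtop : Tendsto N atTop atTop := (hdecay.tendsto_normalization hd hβ_upper).comp hlam
    -- The weights are `shiftSum / N n`, uniformly bounded by `∑ |α| / N n`, which tends to zero.
    refine SpatialCLT.tendstoInDistribution_of_weights hZ.errors _ (fun n => ?_)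
      (fun n j => SpatialCLT.shiftSum α R₀ (lam n) j / N n) (fun n => ?_) (fun n => ?_)
      (fun n => (∑' m, |α m|) / N n) (fun n j => ?_) (tendsto_const_nhds.div_atTop hNtop) ?_
    · simp_rw [div_eq_mul_inv]
      exact ((hZ.memLp_siteSum hR₀ (lam n)).sub (memLp_const _)).mul_const _
    · have h := hZ.tendsto_siteSum hR₀ (hlam_pos n)
      have h' := ENNReal.Tendsto.const_mul (a := ‖(N n)⁻¹‖ₑ) h (Or.inr enorm_ne_top)
      rw [mul_zero] at h'
      refine h'.congr fun s => ?_
      rw [← eLpNorm_const_smul, hZ.integral_siteSum hR₀ (hlam_pos n)]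
      congr 1
      funext ω
      simp only [Pi.smul_apply, smul_eq_mul]
      rw [mul_sub, Finset.mul_sum, div_eq_inv_mul]
      congr 1
      exact Finset.sum_congr rfl fun j _ => by ring
    · simp_rw [div_pow]
      exact (SpatialCLT.summable_shiftSum_sq hA.summable hR₀ (hlam_pos n)).div_const _
    · have hN0 : 0 ≤ N n := Real.sqrt_nonneg _
      rw [abs_div, abs_of_nonneg hN0]
      exact div_le_div_of_nonneg_right
        (SpatialCLT.abs_shiftSum_le_tsum hA.summable _ _ _) hN0
    · refine (hvar.comp hlam).congr fun n => ?_
      exact (SpatialCLT.tsum_weights_sq_eq hA.summable hdecay hR₀ (hlam_pos n)).symm
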